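/- Let $X$ be a smooth manifold (finite-dimensional, Hausdorff, second countable). **Local model.** Let $(d_i)_{i\in\mathbb Z}$ be natural numbers with $d_0=0$ (infinitely many may be non-zero). For an open $W\subset X$ put $R=C^\infty(W)$, let $\mathscr E^*$ be the free graded $R$-module with $d_i$ generators of degree $i$, let $\mathrm{Sym}_R(\mathscr E^*)$ be the free graded commutative $R$-algebra on it (so $ab=(-1)^{\deg a\deg b}ba$), and let $F^p\mathrm{Sym}_R(\mathscr E^*)$ be the ideal generated by all elements of degree $\le -p$. The graded functions on $W$ are $$\mathcal F(W)=\bigoplus_{i\in\mathbb Z}\varprojlim_p\big(\mathrm{Sym}_R(\mathscr E^*)/F^p\mathrm{Sym}_R(\mathscr E^*)\big)_i ,$$ with the projective limit topology, in which the kernels of the projections to $\mathrm{Sym}_R(\mathscr E^*)/F^N\mathrm{Sym}_R(\mathscr E^*)$ are the basic neighbourhoods of zero. **Smooth $\mathbb Z$-graded manifolds.** A smooth $\mathbb Z$-graded manifold $M$ with base $X$ is a sheaf $\mathcal O_M$ on $X$ of $\mathbb Z$-graded supercommutative real algebras (a sheaf in each degree), with a linear topology given by a decreasing sequence of homogeneous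 ideal subsheaves, the basic neighbourhoods of zero, such that every point of $X$ has an open neighbourhood over which $\mathcal O_M$ is isomorphic to a local model. Isomorphisms of such sheaves are over the identity of the base, and they respect the algebra structure, the grading, the restrictions and the basic neighbourhoods of zero. **The canonical filtration.** $F^p\mathcal O_M\subset\mathcal O_M$ is the closed ideal sheaf generated by all elements of degree $\le -p$: its sections are the sections of $\mathcal O_M$ which locally lie in the closure of the ideal generated by all elements of degree $\le -p$. **The manifold $\overline M$.** $\overline M$ has the same base, and its structure sheaf $\mathcal O_{\overline M}=\overline{\mathcal O_M}$ is the completion of the associated graded algebra of this filtration: for open $W\subset X$ and $i\in\mathbb Z$, $$\mathcal O_{\overline M}(W)_i=\prod_{q\ge 0}\big(F^q\mathcal O_M(W)/F^{q+1}\mathcal O_M(W)\big)_i ,$$ with the multiplication induced by $F^q\cdot F^{q'}\subset F^{q+q'}$, where the $q$-th factor has bidegree $(i+q,q)\in\mathbb N^2$ (it vanishes if $i+q<0$), and with the products over $q\ge N$ as basic neighbourhoods of zero. **Lemma.** For every smooth $\mathbb Z$-graded manifold $M$, $\overline M$ is a smooth $\mathbb Z$-graded manifold (in particular, $\mathcal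 O_{\overline M}$ is a sheaf), and there exists an isomorphism $M\simeq\overline M$ of smooth $\mathbb Z$-graded manifolds. -/

import Mathlib

open TopologicalSpace Manifold ContDiff

universe u v w

noncomputable section

/-- A presheaf on `X` of unital `ℤ`-graded supercommutative real algebras.  A graded algebra is
recorded through its homogeneous components: `sec U i` are the sections of degree `i` over `U`,
and the algebra over `U` is the direct sum of these components.
The components carry a linear topology, given by the decreasing sequence of homogeneous ideals
`nhd N`, `N : ℕ`, which form a fundamental system of neighbourhoods of zero. -/
structure GradedPresheaf (X : Type u) [TopologicalSpace X] where
  sec : Opens X → ℤ → Type v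
  [addCommGroup : ∀ U i, AddCommGroup (sec U i)]
  [module : ∀ U i, Module ℝ (sec U i)]
  one : ∀ U, sec U 0
  mul : ∀ (U : Opens X) {i j k : ℤ}, i + j = k → sec U i →ₗ[ℝ] sec U j →ₗ[ℝ] sec U k
  res : ∀ {U V : Opens X}, U ≤ V → ∀ i, sec V i →ₗ[ℝ] sec U i
  nhd : ℕ → ∀ (U : Opens X) (i : ℤ), Submodule ℝ (sec U i)
  one_mul : ∀ {U : Opens X} {i : ℤ} (h : 0 + i = i) (a : sec U i), mul U h (one U) a = a
  mul_comm : ∀ {U : Opens X} {i j k : ℤ} (h : i + j = k) (h' : j + i = k)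
    (a : sec U i) (b : sec U j), mul U h a b = (i * j).negOnePow • mul U h' b a
  mul_assoc : ∀ {U : Opens X} {i j k l m n : ℤ} (hl : i + j = l) (hm : j + k = m)
    (h : l + k = n) (h' : i + m = n) (a : sec U i) (b : sec U j) (c : sec U k),
    mul U h (mul U hl a b) c = mul U h' a (mul U hm b c)
  res_self : ∀ {U : Opens X} (h : U ≤ U) {i : ℤ} (a : sec U i), res h i a = a
  res_res : ∀ {U V W : Opens X} (h : U ≤ V) (h' : V ≤ W) (h'' : U ≤ W) {i : ℤ} (a : sec W i),
    res h i (res h' i a) = res h'' i a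
  res_one : ∀ {U V : Opens X} (h : U ≤ V), res h 0 (one V) = one U
  res_mul : ∀ {U V : Opens X} (h : U ≤ V) {i j k : ℤ} (hk : i + j = k)
    (a : sec V i) (b : sec V j), res h k (mul V hk a b) = mul U hk (res h i a) (res h j b)
  nhd_succ : ∀ (N : ℕ) (U : Opens X) (i : ℤ), nhd (N + 1) U i ≤ nhd N U i
  mul_mem_nhd : ∀ {N : ℕ} {U : Opens X} {i j k : ℤ} (h : i + j = k) (a : sec U i) (b : sec U j),
    b ∈ nhd N U j → mul U h a b ∈ nhd N U k
  res_mem_nhd : ∀ {N : ℕ} {U V : Opens X} (h : U ≤ V) {i : ℤ} (a : sec V i),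
    a ∈ nhd N V i → res h i a ∈ nhd N U i

attribute [instance] GradedPresheaf.addCommGroup GradedPresheaf.module

namespace GradedPresheaf

variable {X : Type u} [TopologicalSpace X]

/-- The sheaf condition, in the category of graded algebras (that is, in each degree), together
with the locality of the topology. -/
structure IsSheaf (A : GradedPresheaf.{u, v} X) : Prop where
  existsUnique_glue : ∀ (κ : Type u) (U : κ → Opens X) (i : ℤ) (s : ∀ k, A.sec (U k) i),
    (∀ k l, A.res (inf_le_left : U k ⊓ U l ≤ U k) i (s k)
      = A.res (inf_le_right : U k ⊓ U l ≤ U l) i (s l)) →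
    ∃! t : A.sec (⨆ k, U k) i, ∀ k, A.res (le_iSup U k) i t = s k
  nhd_local : ∀ (κ : Type u) (U : κ → Opens X) (i : ℤ) (N : ℕ) (t : A.sec (⨆ k, U k) i),
    (∀ k, A.res (le_iSup U k) i t ∈ A.nhd N (U k) i) → t ∈ A.nhd N (⨆ k, U k) i

/-- An isomorphism, over the open set `U`, between two presheaves of graded algebras: a family of
bijections on the sections over the open subsets of `U`, which is compatible with restrictions,
with the algebra structure, with the grading, and with the topology. -/
structure IsoOn (U : Opens X) (A : GradedPresheaf.{u, v} X) (B : GradedPresheaf.{u, w} X) where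
  equiv : ∀ W : Opens X, W ≤ U → ∀ i, A.sec W i ≃ₗ[ℝ] B.sec W i
  map_one : ∀ (W : Opens X) (hW : W ≤ U), equiv W hW 0 (A.one W) = B.one W
  map_mul : ∀ (W : Opens X) (hW : W ≤ U) {i j k : ℤ} (h : i + j = k)
    (a : A.sec W i) (b : A.sec W j),
    equiv W hW k (A.mul W h a b) = B.mul W h (equiv W hW i a) (equiv W hW j b)
  map_res : ∀ (W W' : Opens X) (hW : W ≤ U) (hW' : W' ≤ U) (h : W ≤ W') (i : ℤ)
    (a : A.sec W' i), equiv W hW i (A.res h i a) = B.res h i (equiv W' hW' i a)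
  mem_nhd_iff : ∀ (W : Opens X) (hW : W ≤ U) (N : ℕ) (i : ℤ) (a : A.sec W i),
    equiv W hW i a ∈ B.nhd N W i ↔ a ∈ A.nhd N W i

/-- An isomorphism of presheaves of graded algebras over the whole of `X`. -/
abbrev Iso (A : GradedPresheaf.{u, v} X) (B : GradedPresheaf.{u, w} X) := IsoOn ⊤ A B

variable (A : GradedPresheaf.{u, v} X)

theorem mul_one' {U : Opens X} {i : ℤ} (h : i + 0 = i) (a : A.sec U i) :
    A.mul U h a (A.one U) = a := by
  rw [A.mul_comm h (by omega), A.one_mul]; simp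

/-- The component of degree `i` of the ideal generated by all elements of degree `≤ -p` in the
graded algebra of sections over `U`.  By supercommutativity, left multiples suffice. -/
def idealLE (p : ℕ) (U : Opens X) (i : ℤ) : Submodule ℝ (A.sec U i) :=
  Submodule.span ℝ {s | ∃ (j k : ℤ) (h : j + k = i) (a : A.sec U j) (b : A.sec U k),
    k ≤ -(p : ℤ) ∧ s = A.mul U h a b}

theorem nhd_anti {M N : ℕ} (h : M ≤ N) (U : Opens X) (i : ℤ) : A.nhd N U i ≤ A.nhd M U i := by
  induction h with
  | refl => exact le_rfl
  | step _ ih => exact (A.nhd_succ _ U i).trans ih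

theorem idealLE_anti {p q : ℕ} (h : p ≤ q) (U : Opens X) (i : ℤ) :
    A.idealLE q U i ≤ A.idealLE p U i := by
  refine Submodule.span_mono ?_
  rintro s ⟨j, k, hjk, a, b, hk, rfl⟩
  exact ⟨j, k, hjk, a, b, by omega, rfl⟩

theorem res_mem_idealLE {p : ℕ} {U V : Opens X} (h : U ≤ V) {i : ℤ} {a : A.sec V i}
    (ha : a ∈ A.idealLE p V i) : A.res h i a ∈ A.idealLE p U i := by
  have : A.idealLE p V i ≤ (A.idealLE p U i).comap (A.res h i) := by
    refine Submodule.span_le.2 ?_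
    rintro s ⟨j, k, hjk, a, b, hk, rfl⟩
    exact Submodule.subset_span ⟨j, k, hjk, _, _, hk, A.res_mul h hjk a b⟩
  exact this ha

theorem mul_mem_nhd' {N : ℕ} {U : Opens X} {i j k : ℤ} (h : i + j = k) (a : A.sec U i)
    (b : A.sec U j) (ha : a ∈ A.nhd N U i) : A.mul U h a b ∈ A.nhd N U k := by
  rw [A.mul_comm h (by omega), Units.smul_def]
  exact zsmul_mem (A.mul_mem_nhd _ _ _ ha) _

theorem mul_mem_idealLE {p q : ℕ} {U : Opens X} {i j k : ℤ} (h : i + j = k) {a : A.sec U i}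
    {b : A.sec U j} (ha : a ∈ A.idealLE p U i) (hb : b ∈ A.idealLE q U j) :
    A.mul U h a b ∈ A.idealLE (p + q) U k := by
  have key : A.idealLE p U i ≤ (⨅ b : A.idealLE q U j,
      (A.idealLE (p + q) U k).comap ((A.mul U h).flip b.1)) := by
    refine Submodule.span_le.2 ?_
    rintro s ⟨m, n, hmn, x, a, hn, rfl⟩
    simp only [SetLike.mem_coe, Submodule.mem_iInf, Submodule.mem_comap, LinearMap.flip_apply]
    rintro ⟨b, hb⟩
    have key2 : A.idealLE q U j ≤ (A.idealLE (p + q) U k).comap (A.mul U h (A.mul U hmn x a)) := by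
      refine Submodule.span_le.2 ?_
      rintro t ⟨m', n', hmn', y, b, hn', rfl⟩
      rw [SetLike.mem_coe, Submodule.mem_comap,
        A.mul_assoc hmn (m := n + j) rfl h (by omega),
        ← A.mul_assoc (i := n) (l := n + m') rfl hmn' (by omega) rfl a y b,
        A.mul_comm (i := n) (j := m') rfl (by omega) a y]
      simp only [Units.smul_def, map_zsmul, LinearMap.smul_apply]
      refine zsmul_mem ?_ _
      rw [A.mul_assoc (k := n') (m := n + n') (n := n + j) (by omega) rfl (by omega) (by omega),
        ← A.mul_assoc (l := m + m') rfl (by omega) (by omega) (by omega)]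
      exact Submodule.subset_span ⟨_, _, _, _, _, by push_cast; omega, rfl⟩
    exact key2 hb
  have := key ha
  simp only [Submodule.mem_iInf, Submodule.mem_comap, LinearMap.flip_apply] at this
  exact this ⟨b, hb⟩

/-- The canonical decreasing filtration `F^p` of the structure sheaf: in degree `i` and over `W`,
`F^p` consists of the sections which locally belong to the closure (with respect to the linear
topology) of the ideal generated by all elements of degree `≤ -p`. -/
def canFil (p : ℕ) (W : Opens X) (i : ℤ) : Submodule ℝ (A.sec W i) where
  carrier := {s | ∀ x ∈ W, ∃ (U : Opens X) (hU : U ≤ W), x ∈ U ∧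
    ∀ N : ℕ, A.res hU i s ∈ A.idealLE p U i ⊔ A.nhd N U i}
  zero_mem' := fun x hx => ⟨W, le_rfl, hx, fun N => by rw [map_zero]; exact zero_mem _⟩
  smul_mem' := fun c s hs x hx => by
    obtain ⟨U, hU, hxU, h⟩ := hs x hx
    exact ⟨U, hU, hxU, fun N => by rw [map_smul]; exact Submodule.smul_mem _ _ (h N)⟩
  add_mem' := fun {s t} hs ht x hx => by
    obtain ⟨U, hU, hxU, h⟩ := hs x hx
    obtain ⟨U', hU', hxU', h'⟩ := ht x hx
    have aux : ∀ {V V' : Opens X} (hV : V ≤ V') (r : A.sec V' i) (N : ℕ),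
        r ∈ A.idealLE p V' i ⊔ A.nhd N V' i → A.res hV i r ∈ A.idealLE p V i ⊔ A.nhd N V i := by
      intro V V' hV r N hr
      obtain ⟨y, hy, z, hz, rfl⟩ := Submodule.mem_sup.1 hr
      rw [map_add]
      exact Submodule.add_mem_sup (A.res_mem_idealLE hV hy) (A.res_mem_nhd hV z hz)
    refine ⟨U ⊓ U', inf_le_left.trans hU, ⟨hxU, hxU'⟩, fun N => ?_⟩
    rw [map_add]
    refine add_mem ?_ ?_
    · rw [← A.res_res inf_le_left hU]; exact aux _ _ _ (h N)
    · rw [← A.res_res inf_le_right hU']; exact aux _ _ _ (h' N)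

theorem res_mem_sup {p N : ℕ} {i : ℤ} {U V : Opens X} (h : U ≤ V) {r : A.sec V i}
    (hr : r ∈ A.idealLE p V i ⊔ A.nhd N V i) : A.res h i r ∈ A.idealLE p U i ⊔ A.nhd N U i := by
  obtain ⟨y, hy, z, hz, rfl⟩ := Submodule.mem_sup.1 hr
  rw [map_add]
  exact Submodule.add_mem_sup (A.res_mem_idealLE h hy) (A.res_mem_nhd h z hz)

theorem canFil_anti {p q : ℕ} (h : p ≤ q) (W : Opens X) (i : ℤ) :
    A.canFil q W i ≤ A.canFil p W i := by
  intro s hs x hx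
  obtain ⟨U, hU, hxU, hs⟩ := hs x hx
  exact ⟨U, hU, hxU, fun N => sup_le_sup_right (A.idealLE_anti h U i) _ (hs N)⟩

theorem res_mem_canFil {p : ℕ} {U V : Opens X} (h : U ≤ V) {i : ℤ} {a : A.sec V i}
    (ha : a ∈ A.canFil p V i) : A.res h i a ∈ A.canFil p U i := by
  intro x hx
  obtain ⟨U', hU', hxU', hs⟩ := ha x (h hx)
  refine ⟨U ⊓ U', inf_le_left, ⟨hx, hxU'⟩, fun N => ?_⟩
  rw [A.res_res _ _ (inf_le_right.trans hU'), ← A.res_res inf_le_right hU']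
  exact A.res_mem_sup _ (hs N)

theorem mul_mem_canFil {p q r : ℕ} (hr : p + q = r) {U : Opens X} {i j k : ℤ} (h : i + j = k)
    {a : A.sec U i} {b : A.sec U j} (ha : a ∈ A.canFil p U i) (hb : b ∈ A.canFil q U j) :
    A.mul U h a b ∈ A.canFil r U k := by
  subst hr
  intro x hx
  obtain ⟨V, hV, hxV, ha⟩ := ha x hx
  obtain ⟨V', hV', hxV', hb⟩ := hb x hx
  refine ⟨V ⊓ V', inf_le_left.trans hV, ⟨hxV, hxV'⟩, fun N => ?_⟩
  have ha' := A.res_mem_sup (inf_le_left : V ⊓ V' ≤ V) (ha N)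
  have hb' := A.res_mem_sup (inf_le_right : V ⊓ V' ≤ V') (hb N)
  rw [A.res_res _ _ (inf_le_left.trans hV)] at ha'
  rw [A.res_res _ _ (inf_le_right.trans hV')] at hb'
  rw [A.res_mul]
  obtain ⟨y, hy, z, hz, hyz⟩ := Submodule.mem_sup.1 ha'
  obtain ⟨y', hy', z', hz', hyz'⟩ := Submodule.mem_sup.1 hb'
  rw [← hyz, ← hyz', LinearMap.map_add₂, map_add, _root_.add_assoc]
  exact Submodule.add_mem_sup (A.mul_mem_idealLE h hy hy')
    (add_mem (A.mul_mem_nhd _ _ _ hz') (A.mul_mem_nhd' _ _ _ hz))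

theorem canFil_eq_top {p : ℕ} (W : Opens X) {i : ℤ} (h : i ≤ -(p : ℤ)) : A.canFil p W i = ⊤ := by
  refine eq_top_iff.2 fun s _ x hx => ⟨W, le_rfl, hx, fun N => ?_⟩
  refine Submodule.mem_sup_left (Submodule.subset_span
    ⟨0, i, zero_add i, A.one W, A.res le_rfl i s, h, ?_⟩)
  rw [A.one_mul]

theorem one_mem_canFil (W : Opens X) : A.one W ∈ A.canFil 0 W 0 := by
  rw [A.canFil_eq_top W (by simp)]; trivial

/-- The component `F^q / F^{q+1}` in degree `i`, over `W`, of the associated graded algebra.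
Its bidegree is `(i + q, q)`. -/
abbrev Gr (q : ℕ) (W : Opens X) (i : ℤ) : Type v :=
  A.canFil q W i ⧸ (A.canFil (q + 1) W i).comap (A.canFil q W i).subtype

/-- The class in `F^q / F^{q+1}` of an element of `F^q`. -/
abbrev grMk (q : ℕ) (W : Opens X) (i : ℤ) : A.canFil q W i →ₗ[ℝ] A.Gr q W i :=
  Submodule.mkQ _

theorem grMk_eq_zero {q : ℕ} {W : Opens X} {i : ℤ} {a : A.canFil q W i}
    (ha : a.1 ∈ A.canFil (q + 1) W i) : A.grMk q W i a = 0 :=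
  (Submodule.Quotient.mk_eq_zero _).2 ha

/-- Only the bidegrees `(p, q)` with `p, q ≥ 0` occur in the associated graded algebra. -/
theorem subsingleton_Gr (q : ℕ) (W : Opens X) {i : ℤ} (h : i + q < 0) :
    Subsingleton (A.Gr q W i) := by
  have key : ∀ a : A.Gr q W i, a = 0 := by
    intro a
    obtain ⟨a, rfl⟩ := Submodule.mkQ_surjective _ a
    refine A.grMk_eq_zero ?_
    rw [A.canFil_eq_top W (by push_cast; omega)]
    trivial
  exact ⟨fun a b => (key a).trans (key b).symm⟩

/-- The multiplication `F^p/F^{p+1} × F^q/F^{q+1} → F^{p+q}/F^{p+q+1}` of the associated graded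
algebra. -/
def grMul {p q r : ℕ} (hr : p + q = r) (W : Opens X) {i j k : ℤ} (h : i + j = k) :
    A.Gr p W i →ₗ[ℝ] A.Gr q W j →ₗ[ℝ] A.Gr r W k :=
  Submodule.liftQ _
    (LinearMap.flip (Submodule.liftQ _
      (LinearMap.mk₂ ℝ
        (fun (b : A.canFil q W j) (a : A.canFil p W i) => A.grMk r W k
          ⟨A.mul W h a.1 b.1, A.mul_mem_canFil hr h a.2 b.2⟩)
        (fun b b' a => by rw [← map_add]; congr 1; ext; simp)
        (fun c b a => by rw [← map_smul]; congr 1; ext; simp)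
        (fun b a a' => by rw [← map_add]; congr 1; ext; simp)
        (fun c b a => by rw [← map_smul]; congr 1; ext; simp))
      (fun b hb => by
        rw [LinearMap.mem_ker]
        ext a
        exact A.grMk_eq_zero (A.mul_mem_canFil (by omega) h a.2 hb))))
    (fun a ha => by
      rw [LinearMap.mem_ker]
      refine LinearMap.ext fun b => ?_
      obtain ⟨b, rfl⟩ := Submodule.mkQ_surjective _ b
      exact A.grMk_eq_zero (A.mul_mem_canFil (by omega) h ha b.2))

theorem grMul_mk {p q r : ℕ} (hr : p + q = r) (W : Opens X) {i j k : ℤ} (h : i + j = k)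
    (a : A.canFil p W i) (b : A.canFil q W j) :
    A.grMul hr W h (A.grMk p W i a) (A.grMk q W j b) =
      A.grMk r W k ⟨A.mul W h a.1 b.1, A.mul_mem_canFil hr h a.2 b.2⟩ := rfl

/-- The restriction maps of the associated graded algebra. -/
def grRes (q : ℕ) {U V : Opens X} (h : U ≤ V) (i : ℤ) : A.Gr q V i →ₗ[ℝ] A.Gr q U i :=
  Submodule.mapQ _ _
    (((A.res h i).domRestrict (A.canFil q V i)).codRestrict (A.canFil q U i)
      (fun a => A.res_mem_canFil h a.2))
    (fun _ ha => A.res_mem_canFil h ha)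

theorem grRes_mk (q : ℕ) {U V : Opens X} (h : U ≤ V) (i : ℤ) (a : A.canFil q V i) :
    A.grRes q h i (A.grMk q V i a) =
      A.grMk q U i ⟨A.res h i a.1, A.res_mem_canFil h a.2⟩ := rfl

/-- The unit of the completed associated graded algebra. -/
def barOne (W : Opens X) : ∀ q : ℕ, A.Gr q W 0
  | 0 => A.grMk 0 W 0 ⟨A.one W, A.one_mem_canFil W⟩
  | _ + 1 => 0

/-- The multiplication of the completed associated graded algebra. -/
def barMul (W : Opens X) {i j k : ℤ} (h : i + j = k) :
    (∀ q : ℕ, A.Gr q W i) →ₗ[ℝ] (∀ q : ℕ, A.Gr q W j) →ₗ[ℝ] (∀ q : ℕ, A.Gr q W k) :=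
  LinearMap.mk₂ ℝ
    (fun a b q => ∑ x : Finset.HasAntidiagonal.antidiagonal q,
      A.grMul (Finset.HasAntidiagonal.mem_antidiagonal.1 x.2) W h (a x.1.1) (b x.1.2))
    (fun a a' b => by
      funext q; simp [Finset.sum_add_distrib])
    (fun c a b => by
      funext q; simp [Finset.smul_sum])
    (fun a b b' => by
      funext q; simp [Finset.sum_add_distrib])
    (fun c a b => by
      funext q; simp [Finset.smul_sum])

theorem exists_rep {W : Opens X} {i : ℤ} (a : ∀ q : ℕ, A.Gr q W i) :
    ∃ a' : ∀ q : ℕ, A.canFil q W i, a = fun q => A.grMk q W i (a' q) :=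
  ⟨fun q => (Submodule.mkQ_surjective _ (a q)).choose,
    funext fun q => (Submodule.mkQ_surjective _ (a q)).choose_spec.symm⟩

theorem sum_mul_mem_canFil {W : Opens X} {i j k : ℤ} (h : i + j = k)
    (a : ∀ q : ℕ, A.canFil q W i) (b : ∀ q : ℕ, A.canFil q W j) (q : ℕ) :
    ∑ x ∈ Finset.HasAntidiagonal.antidiagonal q, A.mul W h (a x.1).1 (b x.2).1 ∈ A.canFil q W k :=
  Submodule.sum_mem _ fun x hx =>
    A.mul_mem_canFil (Finset.HasAntidiagonal.mem_antidiagonal.1 hx) h (a x.1).2 (b x.2).2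

theorem barMul_mk {W : Opens X} {i j k : ℤ} (h : i + j = k)
    (a : ∀ q : ℕ, A.canFil q W i) (b : ∀ q : ℕ, A.canFil q W j) :
    A.barMul W h (fun q => A.grMk q W i (a q)) (fun q => A.grMk q W j (b q)) =
      fun q => A.grMk q W k ⟨_, A.sum_mul_mem_canFil h a b q⟩ := by
  funext q
  have : (⟨_, A.sum_mul_mem_canFil h a b q⟩ : A.canFil q W k) =
      ∑ x : Finset.HasAntidiagonal.antidiagonal q, ⟨A.mul W h (a x.1.1).1 (b x.1.2).1,
        A.mul_mem_canFil (Finset.HasAntidiagonal.mem_antidiagonal.1 x.2) h (a x.1.1).2 (b x.1.2).2⟩ := by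
    ext
    simp only [AddSubmonoidClass.coe_finsetSum]
    rw [← Finset.sum_coe_sort]
  rw [this, map_sum]
  rfl

theorem barMul_apply_zero_of_lt {W : Opens X} {i j k : ℤ} (h : i + j = k) {N : ℕ}
    (a : ∀ q : ℕ, A.Gr q W i) (b : ∀ q : ℕ, A.Gr q W j) (hb : ∀ q < N, b q = 0) :
    ∀ q < N, A.barMul W h a b q = 0 := by
  intro q hq
  have e : A.barMul W h a b q = ∑ x : Finset.HasAntidiagonal.antidiagonal q,
      A.grMul (Finset.HasAntidiagonal.mem_antidiagonal.1 x.2) W h (a x.1.1) (b x.1.2) := rfl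
  rw [e]
  refine Finset.sum_eq_zero fun x _ => ?_
  have := Finset.HasAntidiagonal.mem_antidiagonal.1 x.2
  rw [hb x.1.2 (by omega), map_zero]

/-- The structure sheaf of `M̄`: the completion of the associated graded algebra of the canonical
filtration `F^q`.  Its component of degree `i` is the direct product over `q` of the components
`F^q / F^{q+1}` of degree `i`, that is, of bidegree `(i + q, q)`; the neighbourhoods of zero are
the products over `q ≥ N`. -/
def bar : GradedPresheaf.{u, v} X where
  sec W i := ∀ q : ℕ, A.Gr q W i
  one W := A.barOne W
  mul W _ _ _ h := A.barMul W h
  res h i := LinearMap.pi fun q => (A.grRes q h i).comp (LinearMap.proj q)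
  nhd N W i :=
    { carrier := {a | ∀ q < N, a q = 0}
      zero_mem' := fun q _ => rfl
      add_mem' := fun ha hb q hq => by simp [ha q hq, hb q hq]
      smul_mem' := fun c a ha q hq => by simp [ha q hq] }
  one_mul := by
    intro W i h a
    obtain ⟨a, rfl⟩ := A.exists_rep a
    have : A.barOne W = fun q => A.grMk q W 0
        (if hq : q = 0 then ⟨A.one W, hq ▸ A.one_mem_canFil W⟩ else 0) := by
      funext q
      cases q <;> rfl
    rw [this, barMul_mk]
    funext q
    congr 1
    ext
    simp only
    rw [Finset.sum_eq_single (0, q)]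
    · simp [A.one_mul]
    · rintro ⟨x, y⟩ hxy hne
      have : x ≠ 0 := by
        rintro rfl
        simp at hxy
        exact hne (by rw [hxy])
      simp [this]
    · simp
  mul_comm := by
    intro W i j k h h' a b
    obtain ⟨a, rfl⟩ := A.exists_rep a
    obtain ⟨b, rfl⟩ := A.exists_rep b
    rw [barMul_mk, barMul_mk]
    funext q
    rw [Units.smul_def, Pi.smul_apply, ← map_zsmul]
    congr 1
    ext
    rw [AddSubgroupClass.coe_zsmul]
    dsimp only
    rw [← Finset.Nat.sum_antidiagonal_swap, Finset.smul_sum]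
    refine Finset.sum_congr rfl fun x _ => ?_
    rw [A.mul_comm h h', Units.smul_def]
    rfl
  mul_assoc := by
    intro W i j k l m n hl hm h h' a b c
    obtain ⟨a, rfl⟩ := A.exists_rep a
    obtain ⟨b, rfl⟩ := A.exists_rep b
    obtain ⟨c, rfl⟩ := A.exists_rep c
    rw [barMul_mk, barMul_mk, barMul_mk, barMul_mk]
    funext q
    congr 1
    ext
    simp only [map_sum, LinearMap.sum_apply, Finset.sum_sigma']
    apply Finset.sum_nbij' (fun ⟨⟨_i, j⟩, ⟨k, l⟩⟩ ↦ ⟨(k, l + j), (l, j)⟩)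
      (fun ⟨⟨i, _j⟩, ⟨k, l⟩⟩ ↦ ⟨(i + k, l), (i, k)⟩)
    · rintro ⟨⟨x, y⟩, ⟨z, t⟩⟩ hx
      simp at hx ⊢; omega
    · rintro ⟨⟨x, y⟩, ⟨z, t⟩⟩ hx
      simp at hx ⊢; omega
    · rintro ⟨⟨x, y⟩, ⟨z, t⟩⟩ hx
      simp at hx ⊢; omega
    · rintro ⟨⟨x, y⟩, ⟨z, t⟩⟩ hx
      simp at hx ⊢; omega
    · rintro ⟨⟨x, y⟩, ⟨z, t⟩⟩ hx
      exact A.mul_assoc hl hm h h' _ _ _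
  res_self := by
    intro U h i a
    obtain ⟨a, rfl⟩ := A.exists_rep a
    funext q
    simp only [LinearMap.pi_apply, LinearMap.comp_apply, LinearMap.proj_apply, grRes_mk, A.res_self]
  res_res := by
    intro U V W h h' h'' i a
    obtain ⟨a, rfl⟩ := A.exists_rep a
    funext q
    simp only [LinearMap.pi_apply, LinearMap.comp_apply, LinearMap.proj_apply, grRes_mk]
    congr 2
    exact A.res_res h h' h'' _
  res_one := by
    intro U V h
    funext q
    cases q with
    | zero =>
      simp only [LinearMap.pi_apply, LinearMap.comp_apply, LinearMap.proj_apply, barOne, grRes_mk,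
        A.res_one]
    | succ q => simp [barOne]
  res_mul := by
    intro U V h i j k hk a b
    obtain ⟨a, rfl⟩ := A.exists_rep a
    obtain ⟨b, rfl⟩ := A.exists_rep b
    have hr : ∀ {i : ℤ} (a : ∀ q : ℕ, A.canFil q V i),
        (LinearMap.pi fun q => (A.grRes q h i).comp (LinearMap.proj q))
          (fun q => A.grMk q V i (a q)) =
        fun q => A.grMk q U i ⟨A.res h i (a q).1, A.res_mem_canFil h (a q).2⟩ :=
      fun a => rfl
    rw [hr, hr, barMul_mk, barMul_mk, hr]
    funext q
    congr 1
    ext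
    simp only [map_sum, A.res_mul]
  nhd_succ := fun N U i a ha q hq => ha q (by omega)
  mul_mem_nhd := fun h a b hb => A.barMul_apply_zero_of_lt h a b hb
  res_mem_nhd := fun h i a ha q hq => by
    simp only [LinearMap.pi_apply, LinearMap.comp_apply, LinearMap.proj_apply]
    rw [ha q hq, map_zero]

end GradedPresheaf

/-! ### The local model -/

section LocalModel

variable (R : Type u) [CommRing R] (d : ℤ → ℕ)

/-- A homogeneous basis of a graded vector space with `d i` basis vectors of degree `i`. -/
abbrev Gen (d : ℤ → ℕ) := Σ i : ℤ, Fin (d i)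

/-- The supercommutation relations between the generators. -/
inductive SymRel : FreeAlgebra R (Gen d) → FreeAlgebra R (Gen d) → Prop
  | comm (a b : Gen d) : SymRel (FreeAlgebra.ι R a * FreeAlgebra.ι R b)
      ((a.1 * b.1).negOnePow • (FreeAlgebra.ι R b * FreeAlgebra.ι R a))

/-- The free graded commutative algebra `Sym_R(E*)` on the free graded module `E*` which has
`d i` generators of degree `i`. -/
def GSym := RingQuot (SymRel R d)

instance : Ring (GSym R d) := inferInstanceAs (Ring (RingQuot (SymRel R d)))

instance : Algebra R (GSym R d) := inferInstanceAs (Algebra R (RingQuot (SymRel R d)))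

instance [Algebra ℝ R] : Algebra ℝ (GSym R d) :=
  inferInstanceAs (Algebra ℝ (RingQuot (SymRel R d)))

instance [Algebra ℝ R] : IsScalarTower ℝ R (GSym R d) :=
  inferInstanceAs (IsScalarTower ℝ R (RingQuot (SymRel R d)))

/-- The quotient map from the free algebra. -/
def GSym.mk : FreeAlgebra R (Gen d) →ₐ[R] GSym R d := RingQuot.mkAlgHom R (SymRel R d)

/-- The generators of `Sym_R(E*)`. -/
def GSym.gen (a : Gen d) : GSym R d := GSym.mk R d (FreeAlgebra.ι R a)

/-- The monomials of `Sym_R(E*)`. -/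
def GSym.word (l : List (Gen d)) : GSym R d := (l.map (GSym.gen R d)).prod

/-- The homogeneous component of degree `i` of `Sym_R(E*)`. -/
def GSym.deg (i : ℤ) : Submodule R (GSym R d) :=
  Submodule.span R {s | ∃ l : List (Gen d), (l.map Sigma.fst).sum = i ∧ s = GSym.word R d l}

/-- The ideal `F^p Sym_R(E*)` generated by all elements of degree `≤ -p`. -/
def GSym.fil (p : ℕ) : Ideal (GSym R d) :=
  TwoSidedIdeal.asIdeal (TwoSidedIdeal.span {s | ∃ i : ℤ, i ≤ -(p : ℤ) ∧ s ∈ GSym.deg R d i})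

instance (p : ℕ) : (GSym.fil R d p).IsTwoSided := by unfold GSym.fil; infer_instance

namespace GSym

variable {R d}

theorem word_nil : word R d [] = 1 := rfl

theorem word_cons (a : Gen d) (l : List (Gen d)) : word R d (a :: l) = gen R d a * word R d l := by
  simp [word]

theorem word_append (l l' : List (Gen d)) : word R d (l ++ l') = word R d l * word R d l' := by
  simp [word]

theorem one_mem_deg : (1 : GSym R d) ∈ deg R d 0 := Submodule.subset_span ⟨[], rfl, rfl⟩

theorem mul_mem_deg {i j : ℤ} {s t : GSym R d} (hs : s ∈ deg R d i) (ht : t ∈ deg R d j) :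
    s * t ∈ deg R d (i + j) := by
  refine Submodule.span_induction₂ (p := fun s t _ _ => s * t ∈ deg R d (i + j))
    ?_ ?_ ?_ ?_ ?_ ?_ ?_ hs ht
  · rintro _ _ ⟨l, rfl, rfl⟩ ⟨l', rfl, rfl⟩
    exact Submodule.subset_span ⟨l ++ l', by simp, by rw [word_append]⟩
  · intro y _; rw [zero_mul]; exact zero_mem _
  · intro y _; rw [mul_zero]; exact zero_mem _
  · intro x y z _ _ _ h h'; rw [add_mul]; exact add_mem h h'
  · intro x y z _ _ _ h h'; rw [mul_add]; exact add_mem h h'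
  · intro r x y _ _ h; rw [smul_mul_assoc]; exact Submodule.smul_mem _ _ h
  · intro r x y _ _ h; rw [mul_smul_comm]; exact Submodule.smul_mem _ _ h

theorem gen_mul_gen (a b : Gen d) :
    gen R d a * gen R d b = (a.1 * b.1).negOnePow • (gen R d b * gen R d a) := by
  have : mk R d _ = mk R d _ := RingQuot.mkAlgHom_rel R (SymRel.comm (R := R) a b)
  rw [map_mul, Units.smul_def, map_zsmul, map_mul] at this
  exact this

theorem gen_mul_word (a : Gen d) (l : List (Gen d)) :
    gen R d a * word R d l
      = (a.1 * (l.map Sigma.fst).sum).negOnePow • (word R d l * gen R d a) := by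
  induction l with
  | nil => simp [word_nil]
  | cons b l ih =>
    rw [word_cons, ← mul_assoc, gen_mul_gen, smul_mul_assoc, mul_assoc, ih, mul_smul_comm,
      smul_smul, ← Int.negOnePow_add, ← mul_assoc]
    simp [mul_add]

theorem word_mul_word (l l' : List (Gen d)) :
    word R d l * word R d l'
      = ((l.map Sigma.fst).sum * (l'.map Sigma.fst).sum).negOnePow
          • (word R d l' * word R d l) := by
  induction l with
  | nil => simp [word_nil]
  | cons b l ih =>
    rw [word_cons, mul_assoc, ih, mul_smul_comm, ← mul_assoc, gen_mul_word, smul_mul_assoc,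
      smul_smul, ← Int.negOnePow_add, mul_assoc]
    simp [add_mul, add_comm]

theorem mul_comm_of_mem {i j : ℤ} {s t : GSym R d} (hs : s ∈ deg R d i) (ht : t ∈ deg R d j) :
    s * t = (i * j).negOnePow • (t * s) := by
  refine Submodule.span_induction₂ (p := fun s t _ _ => s * t = (i * j).negOnePow • (t * s))
    ?_ ?_ ?_ ?_ ?_ ?_ ?_ hs ht
  · rintro _ _ ⟨l, rfl, rfl⟩ ⟨l', rfl, rfl⟩
    exact word_mul_word l l'
  · intro y _; simp
  · intro y _; simp
  · intro x y z _ _ _ h h'; rw [add_mul, mul_add, smul_add, h, h']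
  · intro x y z _ _ _ h h'; rw [add_mul, mul_add, smul_add, h, h']
  · intro r x y _ _ h; rw [smul_mul_assoc, mul_smul_comm, h, smul_comm]
  · intro r x y _ _ h; rw [smul_mul_assoc, mul_smul_comm, h, smul_comm]

theorem fil_anti {p q : ℕ} (h : p ≤ q) : fil R d q ≤ fil R d p := by
  refine TwoSidedIdeal.asIdeal.monotone (TwoSidedIdeal.span_mono ?_)
  rintro s ⟨i, hi, hs⟩
  exact ⟨i, by omega, hs⟩

theorem induction {motive : GSym R d → Prop} (algebraMap : ∀ r : R, motive (algebraMap R _ r))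
    (gen : ∀ a, motive (gen R d a)) (mul : ∀ x y, motive x → motive y → motive (x * y))
    (add : ∀ x y, motive x → motive y → motive (x + y)) (x : GSym R d) : motive x := by
  obtain ⟨x, rfl⟩ : ∃ y, mk R d y = x := RingQuot.mkAlgHom_surjective R (SymRel R d) x
  induction x using FreeAlgebra.induction with
  | grade0 r => rw [AlgHom.commutes]; exact algebraMap r
  | grade1 a => exact gen a
  | mul x y hx hy => rw [map_mul]; exact mul _ _ hx hy
  | add x y hx hy => rw [map_add]; exact add _ _ hx hy

section map

variable {R' R'' : Type u} [CommRing R'] [CommRing R'']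

/-- The ring homomorphism `Sym_R(E*) → Sym_R'(E'*)` induced by a ring homomorphism `R → R'`: it is
`φ` on scalars, and it sends generators to generators. -/
def map (φ : R →+* R') : GSym R d →+* GSym R' d :=
  letI : Algebra R (GSym R' d) := Algebra.compHom _ φ
  (RingQuot.liftAlgHom R ⟨FreeAlgebra.lift R (gen R' d), by
    rintro _ _ ⟨a, b⟩
    rw [map_mul, Units.smul_def, map_zsmul, map_mul, FreeAlgebra.lift_ι_apply,
      FreeAlgebra.lift_ι_apply, gen_mul_gen, Units.smul_def]⟩ :
    RingQuot (SymRel R d) →ₐ[R] GSym R' d).toRingHom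

theorem map_mk (φ : R →+* R') (x : FreeAlgebra R (Gen d)) :
    letI : Algebra R (GSym R' d) := Algebra.compHom _ φ
    map φ (mk R d x) = FreeAlgebra.lift R (gen R' d) x := by
  let _ : Algebra R (GSym R' d) := Algebra.compHom _ φ
  exact RingQuot.liftAlgHom_mkAlgHom_apply _ _ _ _

theorem map_gen (φ : R →+* R') (a : Gen d) : map φ (gen R d a) = gen R' d a := by
  let _ : Algebra R (GSym R' d) := Algebra.compHom _ φ
  rw [gen, map_mk, FreeAlgebra.lift_ι_apply]

theorem map_algebraMap (φ : R →+* R') (r : R) :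
    map φ (algebraMap R (GSym R d) r) = algebraMap R' (GSym R' d) (φ r) := by
  let _ : Algebra R (GSym R' d) := Algebra.compHom _ φ
  rw [← (mk R d).commutes, map_mk, AlgHom.commutes]
  rfl

theorem map_smul (φ : R →+* R') (r : R) (x : GSym R d) : map φ (r • x) = φ r • map φ x := by
  rw [Algebra.smul_def, map_mul, map_algebraMap, ← Algebra.smul_def]

theorem map_real_smul [Algebra ℝ R] [Algebra ℝ R'] (φ : R →ₐ[ℝ] R') (c : ℝ) (x : GSym R d) :
    map φ.toRingHom (c • x) = c • map φ.toRingHom x := by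
  rw [← algebraMap_smul R c x, map_smul, ← algebraMap_smul R' c (map φ.toRingHom x)]
  exact congrArg (· • map φ.toRingHom x) (φ.commutes c)

theorem map_id (x : GSym R d) : map (RingHom.id R) x = x := by
  induction x using induction with
  | algebraMap r => rw [map_algebraMap]; rfl
  | gen a => rw [map_gen]
  | mul x y hx hy => rw [map_mul, hx, hy]
  | add x y hx hy => rw [map_add, hx, hy]

theorem map_map (φ : R →+* R') (ψ : R' →+* R'') (x : GSym R d) :
    map ψ (map φ x) = map (ψ.comp φ) x := by
  induction x using induction with
  | algebraMap r => simp only [map_algebraMap]; rfl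
  | gen a => simp only [map_gen]
  | mul x y hx hy => simp only [map_mul, hx, hy]
  | add x y hx hy => simp only [map_add, hx, hy]

theorem map_word (φ : R →+* R') (l : List (Gen d)) : map φ (word R d l) = word R' d l := by
  induction l with
  | nil => simp [word_nil]
  | cons a l ih => rw [word_cons, word_cons, map_mul, map_gen, ih]

theorem map_mem_deg (φ : R →+* R') {i : ℤ} {x : GSym R d} (hx : x ∈ deg R d i) :
    map φ x ∈ deg R' d i := by
  refine Submodule.span_induction ?_ ?_ ?_ ?_ hx
  · rintro _ ⟨l, hl, rfl⟩
    exact Submodule.subset_span ⟨l, hl, map_word φ l⟩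
  · rw [map_zero]; exact zero_mem _
  · intro x y _ _ h h'; rw [map_add]; exact add_mem h h'
  · intro r x _ h; rw [map_smul]; exact Submodule.smul_mem _ _ h

theorem fil_le_comap_map (φ : R →+* R') (p : ℕ) :
    fil R d p ≤ (fil R' d p).comap (map φ) := by
  have : TwoSidedIdeal.span {s | ∃ i : ℤ, i ≤ -(p : ℤ) ∧ s ∈ GSym.deg R d i} ≤
      TwoSidedIdeal.comap (map φ)
        (TwoSidedIdeal.span {s | ∃ i : ℤ, i ≤ -(p : ℤ) ∧ s ∈ GSym.deg R' d i}) := by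
    refine TwoSidedIdeal.span_le.2 ?_
    rintro s ⟨i, hi, hs⟩
    exact (TwoSidedIdeal.mem_comap _).2
      (TwoSidedIdeal.subset_span ⟨i, hi, map_mem_deg φ hs⟩)
  intro x hx
  exact (TwoSidedIdeal.mem_comap _).1 (this hx)

/-- The ring homomorphism `Sym_R(E*) / F^p → Sym_R'(E'*) / F^p` induced by `R → R'`. -/
def quotMap (φ : R →+* R') (p : ℕ) : GSym R d ⧸ fil R d p →+* GSym R' d ⧸ fil R' d p :=
  Ideal.Quotient.lift _ ((Ideal.Quotient.mk _).comp (map φ)) fun _ hx =>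
    Ideal.Quotient.eq_zero_iff_mem.2 (fil_le_comap_map φ p hx)

theorem quotMap_mk (φ : R →+* R') (p : ℕ) (x : GSym R d) :
    quotMap φ p (Ideal.Quotient.mk _ x) = Ideal.Quotient.mk _ (map φ x) := rfl

theorem quotMap_factor (φ : R →+* R') {p q : ℕ} (h : p ≤ q) (x : GSym R d ⧸ fil R d q) :
    quotMap φ p (Ideal.Quotient.factor (fil_anti h) x) =
      Ideal.Quotient.factor (fil_anti h) (quotMap φ q x) := by
  obtain ⟨x, rfl⟩ := Ideal.Quotient.mk_surjective x
  rfl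

end map

end GSym

variable [Algebra ℝ R]

/-- The component of degree `i` of the graded projective limit of `Sym_R(E*) / F^p Sym_R(E*)`:
compatible sequences of elements of degree `i` of these quotients. -/
def limSym (i : ℤ) : Submodule ℝ (∀ p : ℕ, GSym R d ⧸ GSym.fil R d p) where
  carrier := {a | (∀ p, ∃ s ∈ GSym.deg R d i, Ideal.Quotient.mk (GSym.fil R d p) s = a p) ∧
    ∀ p q (h : p ≤ q), Ideal.Quotient.factor (GSym.fil_anti h) (a q) = a p}
  zero_mem' := ⟨fun p => ⟨0, zero_mem _, map_zero _⟩, fun p q h => map_zero _⟩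
  add_mem' := by
    rintro a b ⟨ha, ha'⟩ ⟨hb, hb'⟩
    refine ⟨fun p => ?_, fun p q h => ?_⟩
    · obtain ⟨s, hs, hsa⟩ := ha p
      obtain ⟨t, ht, htb⟩ := hb p
      exact ⟨s + t, add_mem hs ht, by rw [map_add, hsa, htb]; rfl⟩
    · rw [Pi.add_apply, map_add, ha' p q h, hb' p q h]; rfl
  smul_mem' := by
    rintro c a ⟨ha, ha'⟩
    refine ⟨fun p => ?_, fun p q h => ?_⟩
    · obtain ⟨s, hs, hsa⟩ := ha p
      refine ⟨algebraMap ℝ R c • s, Submodule.smul_mem _ _ hs, ?_⟩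
      rw [algebraMap_smul, Pi.smul_apply, ← hsa]
      rfl
    · obtain ⟨s, hs, hsa⟩ := ha q
      rw [Pi.smul_apply, Pi.smul_apply, ← ha' p q h, ← hsa]
      rfl

namespace limSym

variable {R d}

/-- The unit of the graded projective limit. -/
def one : limSym R d 0 :=
  ⟨1, fun _ => ⟨1, GSym.one_mem_deg, rfl⟩, fun _ _ _ => map_one _⟩

/-- The multiplication of the graded projective limit. -/
def mul {i j k : ℤ} (h : i + j = k) : limSym R d i →ₗ[ℝ] limSym R d j →ₗ[ℝ] limSym R d k :=
  LinearMap.mk₂ ℝ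
    (fun a b => ⟨a.1 * b.1, by
      refine ⟨fun p => ?_, fun p q hpq => ?_⟩
      · obtain ⟨s, hs, hsa⟩ := a.2.1 p
        obtain ⟨t, ht, htb⟩ := b.2.1 p
        exact ⟨s * t, h ▸ GSym.mul_mem_deg hs ht, by rw [map_mul, hsa, htb]; rfl⟩
      · rw [Pi.mul_apply, map_mul, a.2.2 p q hpq, b.2.2 p q hpq]; rfl⟩)
    (fun a a' b => Subtype.ext (add_mul a.1 a'.1 b.1))
    (fun c a b => Subtype.ext (smul_mul_assoc c a.1 b.1))
    (fun a b b' => Subtype.ext (mul_add a.1 b.1 b'.1))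
    (fun c a b => Subtype.ext (mul_smul_comm c a.1 b.1))

theorem mul_val {i j k : ℤ} (h : i + j = k) (a : limSym R d i) (b : limSym R d j) :
    (mul h a b).1 = a.1 * b.1 := rfl

theorem mul_comm {i j k : ℤ} (h : i + j = k) (h' : j + i = k) (a : limSym R d i)
    (b : limSym R d j) : mul h a b = (i * j).negOnePow • mul h' b a := by
  ext p
  obtain ⟨s, hs, hsa⟩ := a.2.1 p
  obtain ⟨t, ht, htb⟩ := b.2.1 p
  have e : a.1 p * b.1 p = ((i * j).negOnePow : ℤ) • (b.1 p * a.1 p) := by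
    rw [← hsa, ← htb, ← map_mul, GSym.mul_comm_of_mem hs ht, Units.smul_def, map_zsmul, map_mul]
  exact e

variable {R' R'' : Type u} [CommRing R'] [CommRing R''] [Algebra ℝ R'] [Algebra ℝ R'']

/-- The map of graded projective limits induced by a homomorphism of algebras `R → R'`. -/
def map (φ : R →ₐ[ℝ] R') (i : ℤ) : limSym R d i →ₗ[ℝ] limSym R' d i where
  toFun a := ⟨fun p => GSym.quotMap φ.toRingHom p (a.1 p), by
    refine ⟨fun p => ?_, fun p q hpq => ?_⟩
    · obtain ⟨s, hs, hsa⟩ := a.2.1 p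
      exact ⟨GSym.map φ.toRingHom s, GSym.map_mem_deg _ hs, by dsimp only; rw [← hsa]; rfl⟩
    · rw [← GSym.quotMap_factor _ hpq, a.2.2 p q hpq]⟩
  map_add' a b := Subtype.ext (funext fun p => map_add (GSym.quotMap φ.toRingHom p) _ _)
  map_smul' c a := by
    ext p
    obtain ⟨s, hs⟩ := Ideal.Quotient.mk_surjective (a.1 p)
    change GSym.quotMap φ.toRingHom p (c • a.1 p) = c • GSym.quotMap φ.toRingHom p (a.1 p)
    rw [← hs]
    exact congrArg (Ideal.Quotient.mk _) (GSym.map_real_smul φ c s)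

theorem map_val (φ : R →ₐ[ℝ] R') (i : ℤ) (a : limSym R d i) (p : ℕ) :
    (map φ i a).1 p = GSym.quotMap φ.toRingHom p (a.1 p) := rfl

theorem map_id (i : ℤ) (a : limSym R d i) : map (AlgHom.id ℝ R) i a = a := by
  ext p
  obtain ⟨s, hs⟩ := Ideal.Quotient.mk_surjective (a.1 p)
  rw [map_val, ← hs]
  exact congrArg _ (GSym.map_id s)

theorem map_map (φ : R →ₐ[ℝ] R') (ψ : R' →ₐ[ℝ] R'') (i : ℤ) (a : limSym R d i) :
    map ψ i (map φ i a) = map (ψ.comp φ) i a := by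
  ext p
  obtain ⟨s, hs⟩ := Ideal.Quotient.mk_surjective (a.1 p)
  rw [map_val, map_val, map_val, ← hs]
  exact congrArg _ (GSym.map_map _ _ s)

theorem map_one (φ : R →ₐ[ℝ] R') : map φ 0 (one : limSym R d 0) = (one : limSym R' d 0) :=
  Subtype.ext (funext fun p => _root_.map_one (GSym.quotMap φ.toRingHom p))

theorem map_mul (φ : R →ₐ[ℝ] R') {i j k : ℤ} (h : i + j = k) (a : limSym R d i)
    (b : limSym R d j) : map φ k (mul h a b) = mul h (map φ i a) (map φ j b) :=
  Subtype.ext (funext fun p => _root_.map_mul (GSym.quotMap φ.toRingHom p) _ _)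

/-- The kernel of the projection to `Sym_R(E*) / F^N Sym_R(E*)`. -/
def nhd (R : Type u) [CommRing R] [Algebra ℝ R] (d : ℤ → ℕ) (N : ℕ) (i : ℤ) :
    Submodule ℝ (limSym R d i) :=
  LinearMap.ker ((LinearMap.proj N).comp (limSym R d i).subtype)

theorem mem_nhd {N : ℕ} {i : ℤ} {a : limSym R d i} : a ∈ nhd R d N i ↔ a.1 N = 0 := Iff.rfl

end limSym

end LocalModel

section LocalModelSheaf

variable (n : ℕ) (X : Type u) [TopologicalSpace X] [ChartedSpace (EuclideanSpace ℝ (Fin n)) X]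
  (d : ℤ → ℕ)

/-- The algebra of smooth functions on an open subset. -/
abbrev Smooth (W : Opens X) := C^∞⟮𝓡 n, W; ℝ⟯

/-- The restriction of smooth functions. -/
def smoothRes {U V : Opens X} (h : U ≤ V) : Smooth n X V →ₐ[ℝ] Smooth n X U :=
  { ContMDiffMap.restrictRingHom (𝓡 n) 𝓘(ℝ, ℝ) ℝ h with
    commutes' := fun _ => rfl }

/-- The sheaf of graded functions of the local model, whose graded vector space of non-zero degree
coordinates has `d i` coordinates of degree `i`: over `W` it is the graded projective limit of
`Sym_R(E*) / F^p Sym_R(E*)`, where `R` is the algebra of smooth functions on `W`, with the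
topology of a projective limit: the neighbourhood `nhd N` of zero is the kernel of the projection
to `Sym_R(E*) / F^N Sym_R(E*)`. -/
def localModel : GradedPresheaf.{u, u} X where
  sec W i := limSym (Smooth n X W) d i
  one W := limSym.one
  mul W _ _ _ h := limSym.mul h
  res h i := limSym.map (smoothRes n X h) i
  nhd N W i := limSym.nhd (Smooth n X W) d N i
  one_mul h a := Subtype.ext (one_mul a.1)
  mul_comm h h' a b := limSym.mul_comm h h' a b
  mul_assoc hl hm h h' a b c := Subtype.ext (mul_assoc a.1 b.1 c.1)
  res_self h i a := limSym.map_id i a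
  res_res h h' h'' i a := limSym.map_map _ _ i a
  res_one h := limSym.map_one _
  res_mul h i j k hk a b := limSym.map_mul _ hk a b
  nhd_succ N U i a ha := by
    rw [limSym.mem_nhd] at ha ⊢
    rw [← a.2.2 N (N + 1) (Nat.le_succ N), ha, map_zero]
  mul_mem_nhd h a b hb := by
    rw [limSym.mem_nhd] at hb ⊢
    rw [limSym.mul_val, Pi.mul_apply, hb, mul_zero]
  res_mem_nhd h i a ha := by
    rw [limSym.mem_nhd] at ha ⊢
    rw [limSym.map_val, ha, map_zero]

variable {X}

/-- `A` is the structure sheaf of a smooth `ℤ`-graded manifold with base `X`: it is a sheaf of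
graded algebras which is locally isomorphic to the local model for some numbers `d i` of
coordinates of degree `i`, where `d 0 = 0` as the coordinates of degree `0` are those of `X`. -/
structure IsGradedManifold (A : GradedPresheaf.{u, v} X) : Prop where
  isSheaf : A.IsSheaf
  locally_model : ∀ x : X, ∃ U : Opens X, x ∈ U ∧ ∃ d : ℤ → ℕ, d 0 = 0 ∧
    Nonempty (GradedPresheaf.IsoOn U A (localModel n X d))

end LocalModelSheaf

end

/-!
The proof rests on a global *Euler field*: a derivation `E` of degree `0` of the structure sheaf
such that `E - q` maps the `q`-th neighbourhood of zero to the next one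
(`GradedPresheaf.EulerField`).

In a chart, `F^p` is spanned by the monomials whose factors of negative degree have total degree
`≤ -p` (`GSym.mem_fil_iff`); in particular `F^p` is the `p`-th neighbourhood of zero
(`IsGradedManifold.canFil_eq_nhd`).  An Euler field of the chart multiplies each monomial by the
absolute value of the total degree of its factors of negative degree (`localModel.euler`).  The
property of being an Euler field is preserved by combinations `∑ g_k E_k` with `g_k` of degree `0`
and `∑ g_k ≡ 1` modulo `F^1`, so a smooth partition of unity, lifted to the structure sheaf through
the charts, yields an Euler field on the whole manifold (`IsGradedManifold.nonempty_eulerField`).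
Here the lifts through different charts have to be compared: the transition isomorphisms need not
preserve the subalgebra of functions of the base, but they induce the identity on it modulo `F^1`
(`body_equiv_ofBase`), because an isomorphism over the identity of the base respects the open sets
on which a function is invertible.

Given an Euler field, every class in `F^q / F^{q+1}` contains exactly one eigenvector for the
eigenvalue `q` (`EulerField.existsUnique_lift`): as the structure sheaf is complete, `E - q` is
invertible on `F^{q+1}`, where the eigenvalues on the successive quotients are `> q`.  The
eigenvectors multiply like their classes, since `E` is a derivation.  The map which sends a sequence
of classes to the sum of the corresponding series of eigenvectors is therefore an isomorphism from
the completed associated graded algebra to the structure sheaf (`EulerField.barIso`).  Through this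
isomorphism, the completed associated graded algebra inherits the sheaf condition and the charts.
-/

noncomputable section

/-! ### Monomials and their weights -/

section SymAlgebra

variable {R : Type u} [CommRing R] {d : ℤ → ℕ}

/-- The weight of a generator: its degree, and the absolute value of its degree if that degree is
negative, `0` otherwise. -/
def Gen.weight (a : Gen d) : ℤ × ℕ := (a.1, (-a.1).toNat)

/-- The weight of a monomial, additive in the factors.  Its first component is the degree, its
second component is the absolute value of the total degree of the factors of negative degree. -/
def wordWeight (l : List (Gen d)) : ℤ × ℕ := (l.map Gen.weight).sum

namespace GSym

theorem wordWeight_fst (l : List (Gen d)) : (wordWeight l).1 = (l.map Sigma.fst).sum := by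
  induction l with
  | nil => rfl
  | cons a l ih =>
    simp only [wordWeight, List.map_cons, List.sum_cons, Prod.fst_add] at ih ⊢
    rw [ih]
    rfl

theorem wordWeight_append (l l' : List (Gen d)) :
    wordWeight (l ++ l') = wordWeight l + wordWeight l' := by
  simp [wordWeight]

theorem wordWeight_cons (a : Gen d) (l : List (Gen d)) :
    wordWeight (a :: l) = a.weight + wordWeight l := by
  simp [wordWeight]

theorem neg_wordWeight_fst_le (l : List (Gen d)) : -(wordWeight l).1 ≤ (wordWeight l).2 := by
  induction l with
  | nil => simp [wordWeight]
  | cons a l ih =>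
    rw [wordWeight_cons, Prod.fst_add, Prod.snd_add]
    have h1 : a.weight.1 = a.1 := rfl
    have h2 : a.weight.2 = (-a.1).toNat := rfl
    omega

theorem span_word : Submodule.span R (Set.range (word R d)) = ⊤ := by
  refine eq_top_iff.2 fun x _ => ?_
  induction x using induction with
  | algebraMap r =>
    rw [Algebra.algebraMap_eq_smul_one]
    exact Submodule.smul_mem _ _ (Submodule.subset_span ⟨[], rfl⟩)
  | gen a => exact Submodule.subset_span ⟨[a], by simp [word]⟩
  | mul x y hx hy =>
    refine Submodule.span_induction₂
      (p := fun x y _ _ => x * y ∈ Submodule.span R (Set.range (word R d)))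
      ?_ ?_ ?_ ?_ ?_ ?_ ?_ (hx trivial) (hy trivial)
    · rintro _ _ ⟨l, rfl⟩ ⟨l', rfl⟩
      exact Submodule.subset_span ⟨l ++ l', word_append l l'⟩
    · intro y _; rw [zero_mul]; exact zero_mem _
    · intro y _; rw [mul_zero]; exact zero_mem _
    · intro x y z _ _ _ h h'; rw [add_mul]; exact add_mem h h'
    · intro x y z _ _ _ h h'; rw [mul_add]; exact add_mem h h'
    · intro r x y _ _ h; rw [smul_mul_assoc]; exact Submodule.smul_mem _ _ h
    · intro r x y _ _ h; rw [mul_smul_comm]; exact Submodule.smul_mem _ _ h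
  | add x y hx hy => exact add_mem (hx trivial) (hy trivial)

theorem word_induction {motive : GSym R d → Prop} (word : ∀ l, motive (word R d l))
    (zero : motive 0) (add : ∀ x y, motive x → motive y → motive (x + y))
    (smul : ∀ (r : R) x, motive x → motive (r • x)) (x : GSym R d) : motive x := by
  have hx : x ∈ Submodule.span R (Set.range (GSym.word R d)) := span_word (R := R) (d := d) ▸ trivial
  induction hx using Submodule.span_induction with
  | mem x h => obtain ⟨l, rfl⟩ := h; exact word l
  | zero => exact zero
  | add x y _ _ h h' => exact add x y h h'
  | smul r x _ h => exact smul r x h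

/-- The algebra homomorphism which records the weight of a monomial in a group-algebra variable:
it sends a generator `a` of weight `w` to `a T ^ w`. -/
def weightHom : GSym R d →ₐ[R] AddMonoidAlgebra (GSym R d) (ℤ × ℕ) :=
  RingQuot.liftAlgHom R ⟨FreeAlgebra.lift R fun a => AddMonoidAlgebra.single a.weight (gen R d a), by
    rintro _ _ ⟨a, b⟩
    rw [map_mul, Units.smul_def, map_zsmul, map_mul, FreeAlgebra.lift_ι_apply,
      FreeAlgebra.lift_ι_apply, AddMonoidAlgebra.single_mul_single,
      AddMonoidAlgebra.single_mul_single, gen_mul_gen, add_comm b.weight, Units.smul_def]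
    ext x
    simp [AddMonoidAlgebra.coeff_single, Finsupp.single_apply]⟩

theorem weightHom_gen (a : Gen d) :
    weightHom (gen R d a) = AddMonoidAlgebra.single a.weight (gen R d a) :=
  (RingQuot.liftAlgHom_mkAlgHom_apply _ _ _ _).trans (FreeAlgebra.lift_ι_apply _ _)

theorem weightHom_word (l : List (Gen d)) :
    weightHom (word R d l) = AddMonoidAlgebra.single (wordWeight l) (word R d l) := by
  induction l with
  | nil => rw [word_nil, map_one]; rfl
  | cons a l ih =>
    rw [word_cons, map_mul, ih, weightHom_gen, AddMonoidAlgebra.single_mul_single, wordWeight_cons]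

/-- The `R`-linear operator which multiplies each monomial by a function `c` of its weight. -/
def diag (c : ℤ × ℕ → R) : GSym R d →ₗ[R] GSym R d where
  toFun x := (weightHom x).coeff.sum fun w y => c w • y
  map_add' x y := by
    rw [map_add, AddMonoidAlgebra.coeff_add, Finsupp.sum_add_index']
    · simp
    · simp
  map_smul' r x := by
    rw [_root_.map_smul, AddMonoidAlgebra.coeff_smul, Finsupp.sum_smul_index' (by simp),
      Finsupp.smul_sum]
    simp only [smul_comm r, RingHom.id_apply]

theorem diag_word (c : ℤ × ℕ → R) (l : List (Gen d)) :
    diag c (word R d l) = c (wordWeight l) • word R d l := by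
  change (weightHom (word R d l)).coeff.sum _ = _
  rw [weightHom_word, AddMonoidAlgebra.coeff_single, Finsupp.sum_single_index (by simp)]

theorem diag_sub_apply (c c' : ℤ × ℕ → R) (x : GSym R d) :
    diag (c - c') x = diag c x - diag c' x := by
  induction x using word_induction with
  | word l => simp only [diag_word, Pi.sub_apply, sub_smul]
  | zero => simp
  | add x y hx hy => simp only [map_add, hx, hy]; abel
  | smul r x h => rw [_root_.map_smul, h, smul_sub, _root_.map_smul, _root_.map_smul]

theorem diag_const (r : R) (x : GSym R d) : diag (fun _ => r) x = r • x := by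
  induction x using word_induction with
  | word l => rw [diag_word]
  | zero => simp
  | add x y hx hy => simp only [map_add, hx, hy, smul_add]
  | smul s x h => rw [_root_.map_smul, h, smul_comm]

/-- If `c` is additive in the weight, then multiplication of monomials by `c` is a derivation. -/
theorem diag_mul {c : ℤ × ℕ → R} (hc : ∀ w w', c (w + w') = c w + c w') (x y : GSym R d) :
    diag c (x * y) = diag c x * y + x * diag c y := by
  induction x using word_induction with
  | word l =>
    induction y using word_induction with
    | word l' =>
      rw [← word_append, diag_word, diag_word, diag_word, wordWeight_append, hc, word_append,
        add_smul, smul_mul_assoc, mul_smul_comm]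
    | zero => simp
    | add x y hx hy => simp only [mul_add, map_add, hx, hy]; abel
    | smul r y h => simp only [mul_smul_comm, _root_.map_smul, h, smul_add]
  | zero => simp
  | add x y hx hy => simp only [add_mul, map_add, hx, hy]; abel
  | smul r y h => simp only [smul_mul_assoc, _root_.map_smul, h, smul_add]

theorem map_diag {R' : Type u} [CommRing R'] (φ : R →+* R') (c : ℤ × ℕ → R) (x : GSym R d) :
    map φ (diag c x) = diag (fun w => φ (c w)) (map φ x) := by
  induction x using word_induction with
  | word l => rw [diag_word, map_smul, map_word, diag_word]
  | zero => simp
  | add x y hx hy => simp only [map_add, hx, hy]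
  | smul r y h => rw [LinearMap.map_smul, map_smul, h, map_smul, LinearMap.map_smul]

theorem diag_mem_span (c : ℤ × ℕ → R) (P : List (Gen d) → Prop) {x : GSym R d}
    (hx : x ∈ Submodule.span R (word R d '' {l | P l})) :
    diag c x ∈ Submodule.span R (word R d '' {l | P l ∧ c (wordWeight l) ≠ 0}) := by
  induction hx using Submodule.span_induction with
  | mem x h =>
    obtain ⟨l, hl, rfl⟩ := h
    rw [diag_word]
    by_cases h0 : c (wordWeight l) = 0
    · rw [h0, zero_smul]; exact zero_mem _
    · exact Submodule.smul_mem _ _ (Submodule.subset_span ⟨l, ⟨hl, h0⟩, rfl⟩)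
  | zero => rw [map_zero]; exact zero_mem _
  | add x y _ _ h h' => rw [map_add]; exact add_mem h h'
  | smul r x _ h => rw [LinearMap.map_smul]; exact Submodule.smul_mem _ _ h

theorem deg_eq_span (i : ℤ) :
    deg R d i = Submodule.span R (word R d '' {l | (wordWeight l).1 = i}) := by
  unfold deg
  congr 1
  ext s
  simp only [Set.mem_ofPred_eq, Set.mem_image, wordWeight_fst]
  exact ⟨fun ⟨l, h, h'⟩ => ⟨l, h, h'.symm⟩, fun ⟨l, h, h'⟩ => ⟨l, h, h'.symm⟩⟩

theorem diag_mem_deg (c : ℤ × ℕ → R) {i : ℤ} {x : GSym R d} (hx : x ∈ deg R d i) :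
    diag c x ∈ deg R d i := by
  rw [deg_eq_span] at hx ⊢
  exact Submodule.span_mono (Set.image_mono fun l h => h.1) (diag_mem_span c _ hx)

/-- Up to sign, a monomial is the product of a monomial in the generators of non-negative degree
and of a monomial in the generators of negative degree, of degree opposite to the second component
of the weight. -/
theorem word_eq_mul (l : List (Gen d)) : ∃ (ε : ℤˣ) (l₁ l₂ : List (Gen d)),
    word R d l = ε • (word R d l₁ * word R d l₂) ∧ wordWeight l = wordWeight l₁ + wordWeight l₂ ∧
      (wordWeight l₂).1 = -(wordWeight l).2 := by
  induction l with
  | nil => exact ⟨1, [], [], by simp [word_nil], rfl, rfl⟩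
  | cons a l ih =>
    obtain ⟨ε, l₁, l₂, h, h', h''⟩ := ih
    have h1 : a.weight.1 = a.1 := rfl
    have h2 : a.weight.2 = (-a.1).toNat := rfl
    rcases le_or_gt 0 a.1 with ha | ha
    · refine ⟨ε, a :: l₁, l₂, ?_, ?_, ?_⟩
      · rw [word_cons, h, mul_smul_comm, word_cons, mul_assoc]
      · rw [wordWeight_cons, wordWeight_cons, h', add_assoc]
      · rw [wordWeight_cons, Prod.snd_add]
        omega
    · refine ⟨ε * (a.1 * (l₁.map Sigma.fst).sum).negOnePow, l₁, a :: l₂, ?_, ?_, ?_⟩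
      · rw [word_cons, h, mul_smul_comm, ← mul_assoc, gen_mul_word, smul_mul_assoc, mul_smul,
          word_cons, mul_assoc]
      · rw [wordWeight_cons, wordWeight_cons, h', add_left_comm]
      · rw [wordWeight_cons, wordWeight_cons, Prod.snd_add, Prod.fst_add]
        omega

theorem word_mem_fil {p : ℕ} {l : List (Gen d)} (h : p ≤ (wordWeight l).2) :
    word R d l ∈ fil R d p := by
  obtain ⟨ε, l₁, l₂, h1, -, h3⟩ := word_eq_mul (R := R) l
  rw [h1, Units.smul_def]
  refine zsmul_mem (Ideal.mul_mem_left _ _ ?_) _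
  refine TwoSidedIdeal.mem_asIdeal.2 (TwoSidedIdeal.subset_span ⟨(wordWeight l₂).1, ?_, ?_⟩)
  · omega
  · rw [deg_eq_span]
    exact Submodule.subset_span ⟨l₂, rfl, rfl⟩

theorem smul_mem_fil {p : ℕ} (r : R) {x : GSym R d} (hx : x ∈ fil R d p) : r • x ∈ fil R d p := by
  rw [Algebra.smul_def]
  exact Ideal.mul_mem_left _ _ hx

/-- The ideal generated by the elements of degree `≤ -p` is spanned by the monomials whose factors
of negative degree have total degree `≤ -p`. -/
theorem mem_fil_iff {p : ℕ} {x : GSym R d} :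
    x ∈ fil R d p ↔ x ∈ Submodule.span R (word R d '' {l | p ≤ (wordWeight l).2}) := by
  constructor
  · have hmul : ∀ x y : GSym R d, y ∈ Submodule.span R (word R d '' {l | p ≤ (wordWeight l).2}) →
        x * y ∈ Submodule.span R (word R d '' {l | p ≤ (wordWeight l).2}) ∧
        y * x ∈ Submodule.span R (word R d '' {l | p ≤ (wordWeight l).2}) := by
      intro x y hy
      induction x using word_induction with
      | word l =>
        induction hy using Submodule.span_induction with
        | mem x h =>
          obtain ⟨l', hl', rfl⟩ := h
          rw [Set.mem_ofPred_eq] at hl'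
          refine ⟨Submodule.subset_span ⟨l ++ l', ?_, word_append _ _⟩,
            Submodule.subset_span ⟨l' ++ l, ?_, word_append _ _⟩⟩
          all_goals
            rw [Set.mem_ofPred_eq, wordWeight_append, Prod.snd_add]
            omega
        | zero => simp
        | add x y _ _ h h' =>
          rw [mul_add, add_mul]; exact ⟨add_mem h.1 h'.1, add_mem h.2 h'.2⟩
        | smul r x _ h =>
          rw [mul_smul_comm, smul_mul_assoc]
          exact ⟨Submodule.smul_mem _ _ h.1, Submodule.smul_mem _ _ h.2⟩
      | zero => simp
      | add x y h h' => rw [mul_add, add_mul]; exact ⟨add_mem h.1 h'.1, add_mem h.2 h'.2⟩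
      | smul r x h =>
        rw [mul_smul_comm, smul_mul_assoc]
        exact ⟨Submodule.smul_mem _ _ h.1, Submodule.smul_mem _ _ h.2⟩
    intro hx
    have hle : TwoSidedIdeal.span {s | ∃ i : ℤ, i ≤ -(p : ℤ) ∧ s ∈ GSym.deg R d i} ≤
        TwoSidedIdeal.mk'
          (Submodule.span R (word R d '' {l | p ≤ (wordWeight l).2}) : Set (GSym R d))
          (zero_mem _) add_mem neg_mem (fun h => (hmul _ _ h).1) (fun h => (hmul _ _ h).2) := by
      refine TwoSidedIdeal.span_le.2 ?_
      rintro s ⟨i, hi, hs⟩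
      rw [TwoSidedIdeal.coe_mk']
      rw [deg_eq_span] at hs
      refine Submodule.span_mono (Set.image_mono fun l hl => ?_) hs
      have := neg_wordWeight_fst_le l
      rw [Set.mem_ofPred_eq] at hl ⊢
      omega
    exact (TwoSidedIdeal.mem_mk' _ _ _ _ _ _ _).1 (hle (TwoSidedIdeal.mem_asIdeal.1 hx))
  · intro hx
    induction hx using Submodule.span_induction with
    | mem x h => obtain ⟨l, hl, rfl⟩ := h; exact word_mem_fil hl
    | zero => exact zero_mem _
    | add x y _ _ h h' => exact add_mem h h'
    | smul r x _ h => exact smul_mem_fil r h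

theorem diag_mem_fil (c : ℤ × ℕ → R) {p : ℕ} {x : GSym R d} (hx : x ∈ fil R d p) :
    diag c x ∈ fil R d p := by
  rw [mem_fil_iff] at hx ⊢
  exact Submodule.span_mono (Set.image_mono fun l h => h.1) (diag_mem_span c _ hx)

/-- The filtration step increases under an operator which kills the monomials of lowest weight. -/
theorem diag_mem_fil_succ {c : ℤ × ℕ → R} {p : ℕ} (hc : ∀ w : ℤ × ℕ, w.2 = p → c w = 0)
    {x : GSym R d} (hx : x ∈ fil R d p) : diag c x ∈ fil R d (p + 1) := by
  rw [mem_fil_iff] at hx ⊢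
  refine Submodule.span_mono (Set.image_mono fun l h => ?_) (diag_mem_span c _ hx)
  exact Nat.lt_of_le_of_ne h.1 fun h' => h.2 (hc _ h'.symm)

/-- A homogeneous element of the ideal `F^p` is a combination of monomials which are both of the
right degree and in `F^p`. -/
theorem mem_span_of_mem_deg_of_mem_fil {p : ℕ} {i : ℤ} {x : GSym R d} (hx : x ∈ deg R d i)
    (hx' : x ∈ fil R d p) :
    x ∈ Submodule.span R (word R d '' {l | p ≤ (wordWeight l).2 ∧ (wordWeight l).1 = i}) := by
  -- `diag c` is the projection to the component of degree `i`.
  let c : ℤ × ℕ → R := fun w => if w.1 = i then 1 else 0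
  have h : diag c x = x := by
    rw [deg_eq_span] at hx
    have hle : Submodule.span R (word R d '' {l | (wordWeight l).1 = i}) ≤
        LinearMap.eqLocus (diag c) LinearMap.id := by
      refine Submodule.span_le.2 ?_
      rintro _ ⟨l, hl, rfl⟩
      rw [SetLike.mem_coe, LinearMap.mem_eqLocus, diag_word,
        show c (wordWeight l) = 1 from if_pos hl, one_smul, LinearMap.id_apply]
    exact hle hx
  have hsub : {l : List (Gen d) | (p ≤ (wordWeight l).2) ∧ c (wordWeight l) ≠ 0} ⊆
      {l | p ≤ (wordWeight l).2 ∧ (wordWeight l).1 = i} := by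
    rintro l ⟨hl, h0⟩
    exact ⟨hl, by_contra fun h1 => h0 (if_neg h1)⟩
  rw [← h]
  exact Submodule.span_mono (Set.image_mono hsub) (diag_mem_span c _ (mem_fil_iff.1 hx'))

end GSym

end SymAlgebra

/-! ### The graded projective limit -/

section LimSym

variable {R : Type u} [CommRing R] {d : ℤ → ℕ}

namespace GSym

/-- The operator induced by `GSym.diag` on `Sym_R(E*) / F^p`. -/
def quotDiag (c : ℤ × ℕ → R) (p : ℕ) : GSym R d ⧸ fil R d p →+ GSym R d ⧸ fil R d p :=
  QuotientAddGroup.map (fil R d p).toAddSubgroup (fil R d p).toAddSubgroup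
    (diag c).toAddMonoidHom fun _ hx => diag_mem_fil c hx

theorem quotDiag_mk (c : ℤ × ℕ → R) (p : ℕ) (x : GSym R d) :
    quotDiag c p (Ideal.Quotient.mk _ x) = Ideal.Quotient.mk _ (diag c x) := rfl

/-- The algebra homomorphism `Sym_R(E*) → R` which sends the generators to zero. -/
def augmentation : GSym R d →ₐ[R] R :=
  RingQuot.liftAlgHom R ⟨FreeAlgebra.lift R fun _ => 0, by
    rintro _ _ ⟨a, b⟩
    simp [Units.smul_def]⟩

theorem augmentation_gen (a : Gen d) : augmentation (gen R d a) = 0 :=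
  (RingQuot.liftAlgHom_mkAlgHom_apply _ _ _ _).trans (FreeAlgebra.lift_ι_apply _ _)

theorem augmentation_word_of_ne_nil {l : List (Gen d)} (h : l ≠ []) :
    augmentation (word R d l) = 0 := by
  obtain ⟨a, l, rfl⟩ := List.exists_cons_of_ne_nil h
  rw [word_cons, map_mul, augmentation_gen, zero_mul]

theorem augmentation_eq_zero_of_mem_fil {x : GSym R d} (hx : x ∈ fil R d 1) :
    augmentation x = 0 := by
  rw [mem_fil_iff] at hx
  induction hx using Submodule.span_induction with
  | mem x h =>
    obtain ⟨l, hl, rfl⟩ := h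
    refine augmentation_word_of_ne_nil ?_
    rintro rfl
    simp [wordWeight] at hl
  | zero => exact map_zero _
  | add x y _ _ h h' => rw [map_add, h, h', add_zero]
  | smul r x _ h => rw [_root_.map_smul, h, smul_zero]

/-- If all generators have non-zero degree, a non-trivial monomial of degree `0` has a factor of
negative degree. -/
theorem one_le_wordWeight_snd (hd : d 0 = 0) {l : List (Gen d)} (hl : l ≠ [])
    (h : (wordWeight l).1 = 0) : 1 ≤ (wordWeight l).2 := by
  have key : ∀ l : List (Gen d), (wordWeight l).2 = 0 → (l.length : ℤ) ≤ (wordWeight l).1 := by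
    intro l
    induction l with
    | nil => simp [wordWeight]
    | cons a l ih =>
      rw [wordWeight_cons, Prod.fst_add, Prod.snd_add, List.length_cons]
      intro h0
      have h1 : a.weight.1 = a.1 := rfl
      have h2 : a.weight.2 = (-a.1).toNat := rfl
      have h3 : a.1 ≠ 0 := fun h3 => by
        have := Fin.pos a.2
        rw [h3, hd] at this
        exact lt_irrefl _ this
      have := ih (by omega)
      push_cast
      omega
  have h1 := List.length_pos_iff.2 hl
  by_contra h0
  have := key l (by omega)
  omega

theorem sub_augmentation_mem_fil (hd : d 0 = 0) {x : GSym R d} (hx : x ∈ deg R d 0) :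
    x - algebraMap R _ (augmentation x) ∈ fil R d 1 := by
  rw [deg_eq_span] at hx
  induction hx using Submodule.span_induction with
  | mem x h =>
    obtain ⟨l, hl, rfl⟩ := h
    rcases eq_or_ne l [] with rfl | h0
    · rw [word_nil, map_one, map_one, sub_self]
      exact zero_mem _
    · rw [augmentation_word_of_ne_nil h0, map_zero, sub_zero]
      exact word_mem_fil (one_le_wordWeight_snd hd h0 hl)
  | zero => simp
  | add x y _ _ h h' =>
    rw [map_add, map_add, add_sub_add_comm]
    exact add_mem h h'
  | smul r x _ h =>
    rw [_root_.map_smul, smul_eq_mul, map_mul, ← Algebra.smul_def, ← smul_sub]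
    exact smul_mem_fil r h

theorem augmentation_map {R' : Type u} [CommRing R'] (φ : R →+* R') (x : GSym R d) :
    augmentation (map φ x) = φ (augmentation x) := by
  induction x using induction with
  | algebraMap r => rw [map_algebraMap, AlgHom.commutes, AlgHom.commutes]; rfl
  | gen a => rw [map_gen, augmentation_gen, augmentation_gen, map_zero]
  | mul x y hx hy => simp only [map_mul, hx, hy]
  | add x y hx hy => simp only [map_add, hx, hy]

/-- The ring homomorphism `Sym_R(E*) / F^1 → R` which sends the generators to zero. -/
def quotAugmentation : GSym R d ⧸ fil R d 1 →+* R :=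
  Ideal.Quotient.lift _ (augmentation : GSym R d →ₐ[R] R).toRingHom
    fun _ hx => augmentation_eq_zero_of_mem_fil hx

end GSym

variable [Algebra ℝ R]

namespace limSym

theorem eq_zero_of_forall_mem_nhd {i : ℤ} {a : limSym R d i} (h : ∀ N, a ∈ nhd R d N i) : a = 0 :=
  Subtype.ext (funext h)

theorem nhd_le_nhd {p q : ℕ} (h : p ≤ q) (i : ℤ) : nhd R d q i ≤ nhd R d p i := by
  intro a ha
  rw [mem_nhd] at ha ⊢
  rw [← a.2.2 p q h, ha, map_zero]

/-- The graded projective limit is complete. -/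
theorem exists_limit {i : ℤ} (b : ℕ → limSym R d i) (hb : ∀ m, b (m + 1) - b m ∈ nhd R d m i) :
    ∃ t : limSym R d i, ∀ m, t - b m ∈ nhd R d m i := by
  have key : ∀ p q, p ≤ q → (b q).1 p = (b p).1 p := by
    intro p q h
    induction q, h using Nat.le_induction with
    | base => rfl
    | succ q hq ih =>
      have := nhd_le_nhd hq i (hb q)
      rw [mem_nhd] at this
      exact (sub_eq_zero.1 this).trans ih
  refine ⟨⟨fun p => (b p).1 p, fun p => (b p).2.1 p, fun p q h => ?_⟩, fun m => ?_⟩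
  · rw [(b q).2.2 p q h, key p q h]
  · exact sub_self _

/-- The element of the graded projective limit which is defined by a homogeneous element of
`Sym_R(E*)`. -/
def ofSym {i : ℤ} (s : GSym R d) (hs : s ∈ GSym.deg R d i) : limSym R d i :=
  ⟨fun _ => Ideal.Quotient.mk _ s, fun _ => ⟨s, hs, rfl⟩, fun _ _ _ => rfl⟩

theorem ofSym_val {i : ℤ} (s : GSym R d) (hs : s ∈ GSym.deg R d i) (p : ℕ) :
    (ofSym s hs).1 p = Ideal.Quotient.mk _ s := rfl

theorem mem_nhd_of_le {p : ℕ} {i : ℤ} (h : i ≤ -(p : ℤ)) (a : limSym R d i) :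
    a ∈ nhd R d p i := by
  obtain ⟨s, hs, hsa⟩ := a.2.1 p
  rw [mem_nhd, ← hsa, Ideal.Quotient.eq_zero_iff_mem]
  exact TwoSidedIdeal.mem_asIdeal.2 (TwoSidedIdeal.subset_span ⟨i, h, hs⟩)

/-- A homogeneous element of the ideal `F^p Sym_R(E*)` is a sum of products of homogeneous
elements, the second ones being of degree `≤ -p`. -/
theorem ofSym_mem_span {p : ℕ} {i : ℤ} {s : GSym R d} (hs : s ∈ GSym.deg R d i)
    (hs' : s ∈ GSym.fil R d p) :
    ofSym s hs ∈ Submodule.span ℝ {x | ∃ (j k : ℤ) (h : j + k = i) (a : limSym R d j)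
      (b : limSym R d k), k ≤ -(p : ℤ) ∧ x = mul h a b} := by
  have h := GSym.mem_span_of_mem_deg_of_mem_fil hs hs'
  have key : ∃ hs : s ∈ GSym.deg R d i, ofSym s hs ∈ Submodule.span ℝ {x | ∃ (j k : ℤ)
      (h : j + k = i) (a : limSym R d j) (b : limSym R d k), k ≤ -(p : ℤ) ∧ x = mul h a b} := by
    clear hs hs'
    induction h using Submodule.closure_induction with
    | zero => exact ⟨zero_mem _, zero_mem _⟩
    | add x y _ _ h h' =>
      obtain ⟨h1, h2⟩ := h
      obtain ⟨h1', h2'⟩ := h'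
      exact ⟨add_mem h1 h1', add_mem h2 h2'⟩
    | smul_mem r x hx =>
      obtain ⟨l, ⟨hl, hl'⟩, rfl⟩ := hx
      obtain ⟨ε, l₁, l₂, h1, h2, h3⟩ := GSym.word_eq_mul (R := R) l
      have hm : ∀ l : List (Gen d), GSym.word R d l ∈ GSym.deg R d (wordWeight l).1 := fun l => by
        rw [GSym.deg_eq_span]
        exact Submodule.subset_span ⟨l, rfl, rfl⟩
      refine ⟨Submodule.smul_mem _ _ (hl' ▸ hm l), Submodule.subset_span
        ⟨(wordWeight l₁).1, (wordWeight l₂).1, by rw [← Prod.fst_add, ← h2, hl'],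
        ofSym (r • (ε : ℤ) • GSym.word R d l₁) (Submodule.smul_mem _ _ (zsmul_mem (hm l₁) _)),
        ofSym (GSym.word R d l₂) (hm l₂), by omega, ?_⟩⟩
      ext p
      rw [mul_val, Pi.mul_apply, ofSym_val, ofSym_val, ofSym_val, ← _root_.map_mul, h1,
        Units.smul_def, smul_mul_assoc, smul_mul_assoc]
  exact key.2

/-- The operator which multiplies the monomials by a function `c` of their weight. -/
def diag (c : ℤ × ℕ → R) (i : ℤ) : limSym R d i →ₗ[ℝ] limSym R d i where
  toFun a := ⟨fun p => GSym.quotDiag c p (a.1 p), by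
    refine ⟨fun p => ?_, fun p q hpq => ?_⟩
    · obtain ⟨s, hs, hsa⟩ := a.2.1 p
      exact ⟨GSym.diag c s, GSym.diag_mem_deg c hs, by dsimp only; rw [← hsa]; rfl⟩
    · obtain ⟨s, hs, hsa⟩ := a.2.1 q
      dsimp only
      rw [← a.2.2 p q hpq, ← hsa]
      rfl⟩
  map_add' a b := Subtype.ext (funext fun p => map_add (GSym.quotDiag c p) _ _)
  map_smul' r a := by
    ext p
    obtain ⟨s, hs⟩ := Ideal.Quotient.mk_surjective (a.1 p)
    change GSym.quotDiag c p (r • a.1 p) = r • GSym.quotDiag c p (a.1 p)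
    rw [← hs]
    refine congrArg (Ideal.Quotient.mk _) (?_ : GSym.diag c (r • s) = r • GSym.diag c s)
    rw [← algebraMap_smul R r s, LinearMap.map_smul, algebraMap_smul]

theorem diag_val (c : ℤ × ℕ → R) (i : ℤ) (a : limSym R d i) (p : ℕ) :
    (diag c i a).1 p = GSym.quotDiag c p (a.1 p) := rfl

theorem diag_mul {c : ℤ × ℕ → R} (hc : ∀ w w', c (w + w') = c w + c w') {i j k : ℤ}
    (h : i + j = k) (a : limSym R d i) (b : limSym R d j) :
    diag c k (mul h a b) = mul h (diag c i a) b + mul h a (diag c j b) := by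
  ext p
  obtain ⟨s, hs⟩ := Ideal.Quotient.mk_surjective (a.1 p)
  obtain ⟨t, ht⟩ := Ideal.Quotient.mk_surjective (b.1 p)
  change GSym.quotDiag c p (a.1 p * b.1 p) =
    GSym.quotDiag c p (a.1 p) * b.1 p + a.1 p * GSym.quotDiag c p (b.1 p)
  rw [← hs, ← ht]
  exact congrArg (Ideal.Quotient.mk _) (GSym.diag_mul hc s t)

theorem map_diag {R' : Type u} [CommRing R'] [Algebra ℝ R'] (φ : R →ₐ[ℝ] R') (c : ℤ × ℕ → R)
    (i : ℤ) (a : limSym R d i) :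
    map φ i (diag c i a) = diag (fun w => φ (c w)) i (map φ i a) := by
  ext p
  obtain ⟨s, hs⟩ := Ideal.Quotient.mk_surjective (a.1 p)
  rw [map_val, diag_val, diag_val, map_val, ← hs]
  exact congrArg (Ideal.Quotient.mk _) (GSym.map_diag φ.toRingHom c s)

/-- The inclusion of the functions of the base. -/
def ofBase : R →ₗ[ℝ] limSym R d 0 where
  toFun r := ofSym (algebraMap R _ r) (by
    rw [Algebra.algebraMap_eq_smul_one]
    exact Submodule.smul_mem _ _ GSym.one_mem_deg)
  map_add' r s := Subtype.ext (funext fun p => by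
    rw [ofSym_val, map_add, map_add]; rfl)
  map_smul' c r := Subtype.ext (funext fun p => by
    rw [ofSym_val, ← algebraMap_smul R c r, smul_eq_mul, _root_.map_mul, ← Algebra.smul_def,
      algebraMap_smul]
    rfl)

theorem ofBase_val (r : R) (p : ℕ) :
    (ofBase r : limSym R d 0).1 p = Ideal.Quotient.mk _ (algebraMap R _ r) := rfl

theorem ofBase_one : (ofBase (1 : R) : limSym R d 0) = one :=
  Subtype.ext (funext fun p => by rw [ofBase_val, _root_.map_one, _root_.map_one]; rfl)

theorem ofBase_mul (h : (0 : ℤ) + 0 = 0) (r s : R) :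
    (ofBase (r * s) : limSym R d 0) = mul h (ofBase r) (ofBase s) :=
  Subtype.ext (funext fun p => by rw [ofBase_val, _root_.map_mul, _root_.map_mul]; rfl)

theorem map_ofBase {R' : Type u} [CommRing R'] [Algebra ℝ R'] (φ : R →ₐ[ℝ] R') (r : R) :
    map φ 0 (ofBase r : limSym R d 0) = ofBase (φ r) :=
  Subtype.ext (funext fun p => by
    rw [map_val, ofBase_val, ofBase_val]
    exact congrArg (Ideal.Quotient.mk _) (GSym.map_algebraMap φ.toRingHom r))

/-- If `c` agrees with a constant `r` on the weights `w` with `w.2 = q`, then `diag c` is the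
multiplication by `r` modulo the next step of the filtration. -/
theorem diag_sub_mem_nhd {c : ℤ × ℕ → R} {q : ℕ} {r : R} (hc : ∀ w : ℤ × ℕ, w.2 = q → c w = r)
    {i : ℤ} (h : 0 + i = i) {a : limSym R d i} (ha : a ∈ nhd R d q i) :
    diag c i a - mul h (ofBase r) a ∈ nhd R d (q + 1) i := by
  obtain ⟨s, hs⟩ := Ideal.Quotient.mk_surjective (a.1 (q + 1))
  have hsq : s ∈ GSym.fil R d q := by
    rw [← Ideal.Quotient.eq_zero_iff_mem, ← mem_nhd.1 ha, ← a.2.2 q (q + 1) (Nat.le_succ q), ← hs]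
    rfl
  have h1 : (diag c i a - mul h (ofBase r) a).1 (q + 1) = Ideal.Quotient.mk _
      (GSym.diag (c - fun _ => r) s) := by
    rw [GSym.diag_sub_apply, GSym.diag_const, map_sub, Algebra.smul_def, _root_.map_mul]
    change GSym.quotDiag c _ (a.1 (q + 1)) -
      Ideal.Quotient.mk _ (algebraMap R _ r) * a.1 (q + 1) = _
    rw [← hs]
    rfl
  rw [mem_nhd, h1, Ideal.Quotient.eq_zero_iff_mem]
  exact GSym.diag_mem_fil_succ (fun w hw => by rw [Pi.sub_apply, hc w hw, sub_self]) hsq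

theorem diag_zero (i : ℤ) (a : limSym R d i) : diag (0 : ℤ × ℕ → R) i a = 0 := by
  ext p
  obtain ⟨s, hs⟩ := Ideal.Quotient.mk_surjective (a.1 p)
  rw [diag_val, ← hs, GSym.quotDiag_mk, show (0 : ℤ × ℕ → R) = fun _ => 0 from rfl,
    GSym.diag_const, zero_smul, map_zero]
  rfl

/-- The function on the base which underlies a function of degree `0`. -/
def body : limSym R d 0 →ₗ[ℝ] R where
  toFun a := GSym.quotAugmentation (a.1 1)
  map_add' a b := map_add GSym.quotAugmentation _ _
  map_smul' c a := by
    obtain ⟨s, hs⟩ := Ideal.Quotient.mk_surjective (a.1 1)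
    change GSym.quotAugmentation (c • a.1 1) = c • GSym.quotAugmentation (a.1 1)
    rw [← hs]
    change GSym.augmentation (c • s) = c • GSym.augmentation s
    rw [← algebraMap_smul R c s, _root_.map_smul, algebraMap_smul]

theorem body_mul (h : (0 : ℤ) + 0 = 0) (a b : limSym R d 0) :
    body (mul h a b) = body a * body b :=
  _root_.map_mul GSym.quotAugmentation _ _

theorem body_ofBase (r : R) : body (ofBase r : limSym R d 0) = r :=
  AlgHom.commutes GSym.augmentation r

theorem body_one : body (one : limSym R d 0) = 1 := by
  rw [← ofBase_one, body_ofBase]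

theorem body_map {R' : Type u} [CommRing R'] [Algebra ℝ R'] (φ : R →ₐ[ℝ] R') (a : limSym R d 0) :
    body (map φ 0 a) = φ (body a) := by
  obtain ⟨s, hs⟩ := Ideal.Quotient.mk_surjective (a.1 1)
  change GSym.quotAugmentation (GSym.quotMap φ.toRingHom 1 (a.1 1)) =
    φ (GSym.quotAugmentation (a.1 1))
  rw [← hs]
  exact GSym.augmentation_map φ.toRingHom s

theorem sub_ofBase_body_mem_nhd (hd : d 0 = 0) (a : limSym R d 0) :
    a - ofBase (body a) ∈ nhd R d 1 0 := by
  obtain ⟨s, hs, hsa⟩ := a.2.1 1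
  have h1 : (a - ofBase (body a)).1 1 =
      Ideal.Quotient.mk _ (s - algebraMap R _ (GSym.augmentation s)) := by
    change a.1 1 - Ideal.Quotient.mk _ (algebraMap R _ (GSym.quotAugmentation (a.1 1))) = _
    rw [← hsa]
    rfl
  rw [mem_nhd, h1, Ideal.Quotient.eq_zero_iff_mem]
  exact GSym.sub_augmentation_mem_fil hd hs

end limSym

end LimSym

/-! ### Isomorphisms and gluing of graded presheaves -/

namespace GradedPresheaf

variable {X : Type u} [TopologicalSpace X]

section IsoOn

variable {U : Opens X} {A : GradedPresheaf.{u, v} X} {B : GradedPresheaf.{u, w} X}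

/-- The inverse of an isomorphism. -/
def IsoOn.symm (e : IsoOn U A B) : IsoOn U B A where
  equiv W hW i := (e.equiv W hW i).symm
  map_one W hW := by rw [LinearEquiv.symm_apply_eq, e.map_one]
  map_mul W hW i j k h a b := by
    rw [LinearEquiv.symm_apply_eq, e.map_mul, LinearEquiv.apply_symm_apply,
      LinearEquiv.apply_symm_apply]
  map_res W W' hW hW' h i a := by
    rw [LinearEquiv.symm_apply_eq, e.map_res W W' hW hW', LinearEquiv.apply_symm_apply]
  mem_nhd_iff W hW N i a := by
    rw [← e.mem_nhd_iff W hW, LinearEquiv.apply_symm_apply]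

/-- The restriction of an isomorphism to a smaller open set. -/
def IsoOn.mono {V : Opens X} (e : IsoOn U A B) (h : V ≤ U) : IsoOn V A B where
  equiv W hW := e.equiv W (hW.trans h)
  map_one W hW := e.map_one W (hW.trans h)
  map_mul W hW _ _ _ := e.map_mul W (hW.trans h)
  map_res W W' hW hW' := e.map_res W W' (hW.trans h) (hW'.trans h)
  mem_nhd_iff W hW := e.mem_nhd_iff W (hW.trans h)

/-- The composition of two isomorphisms. -/
def IsoOn.trans {C : GradedPresheaf X} (e : IsoOn U A B) (e' : IsoOn U B C) : IsoOn U A C where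
  equiv W hW i := (e.equiv W hW i).trans (e'.equiv W hW i)
  map_one W hW := by rw [LinearEquiv.trans_apply, e.map_one, e'.map_one]
  map_mul W hW i j k h a b := by simp only [LinearEquiv.trans_apply, e.map_mul, e'.map_mul]
  map_res W W' hW hW' h i a := by
    simp only [LinearEquiv.trans_apply, e.map_res W W' hW hW', e'.map_res W W' hW hW']
  mem_nhd_iff W hW N i a := by rw [LinearEquiv.trans_apply, e'.mem_nhd_iff, e.mem_nhd_iff]

theorem IsoOn.mem_idealLE (e : IsoOn U A B) {W : Opens X} (hW : W ≤ U) {p : ℕ} {i : ℤ}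
    {a : A.sec W i} (ha : a ∈ A.idealLE p W i) : e.equiv W hW i a ∈ B.idealLE p W i := by
  have : A.idealLE p W i ≤ (B.idealLE p W i).comap (e.equiv W hW i).toLinearMap := by
    refine Submodule.span_le.2 ?_
    rintro s ⟨j, k, hjk, a, b, hk, rfl⟩
    exact Submodule.subset_span ⟨j, k, hjk, _, _, hk, e.map_mul W hW hjk a b⟩
  exact this ha

/-- The sheaf condition is invariant under isomorphisms. -/
theorem IsSheaf.of_iso (e : Iso A B) (hA : A.IsSheaf) : B.IsSheaf where
  existsUnique_glue κ U i s hs := by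
    obtain ⟨t, ht, ht'⟩ := hA.existsUnique_glue κ U i
      (fun k => (e.equiv (U k) le_top i).symm (s k)) (fun k l => by
        refine (e.equiv _ le_top i).injective ?_
        rw [e.map_res _ (U k) le_top le_top, e.map_res _ (U l) le_top le_top,
          LinearEquiv.apply_symm_apply, LinearEquiv.apply_symm_apply, hs])
    refine ⟨e.equiv _ le_top i t, fun k => ?_, fun t' h => ?_⟩
    · rw [← e.map_res _ _ le_top le_top, ht, LinearEquiv.apply_symm_apply]
    · rw [← LinearEquiv.symm_apply_eq]
      refine ht' _ fun k => ?_
      rw [LinearEquiv.eq_symm_apply, e.map_res _ _ le_top le_top, LinearEquiv.apply_symm_apply, h]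
  nhd_local κ U i N t ht := by
    obtain ⟨t, rfl⟩ := (e.equiv _ le_top i).surjective t
    rw [e.mem_nhd_iff]
    refine hA.nhd_local κ U i N t fun k => ?_
    rw [← e.mem_nhd_iff _ le_top, e.map_res _ _ le_top le_top]
    exact ht k

end IsoOn

section Local

variable {A : GradedPresheaf.{u, v} X}

theorem eq_iSup_of_forall_mem {κ : Type*} {W : Opens X} {V : κ → Opens X} (hV : ∀ k, V k ≤ W)
    (h : ∀ x ∈ W, ∃ k, x ∈ V k) : W = ⨆ k, V k :=
  le_antisymm (fun x hx => Opens.mem_iSup.2 (h x hx)) (iSup_le hV)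

theorem IsSheaf.existsUnique_glue_of_eq (hA : A.IsSheaf) {κ : Type u} {W : Opens X}
    {V : κ → Opens X} (hW : W = ⨆ k, V k) (hV : ∀ k, V k ≤ W) {i : ℤ} (s : ∀ k, A.sec (V k) i)
    (hs : ∀ k l, A.res (inf_le_left : V k ⊓ V l ≤ V k) i (s k)
      = A.res (inf_le_right : V k ⊓ V l ≤ V l) i (s l)) :
    ∃! t : A.sec W i, ∀ k, A.res (hV k) i t = s k := by
  subst hW
  exact hA.existsUnique_glue κ V i s hs

theorem IsSheaf.mem_nhd_of_eq (hA : A.IsSheaf) {κ : Type u} {W : Opens X} {V : κ → Opens X}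
    (hW : W = ⨆ k, V k) (hV : ∀ k, V k ≤ W) {i : ℤ} {N : ℕ} {t : A.sec W i}
    (ht : ∀ k, A.res (hV k) i t ∈ A.nhd N (V k) i) : t ∈ A.nhd N W i := by
  subst hW
  exact hA.nhd_local κ V i N t ht

theorem IsSheaf.mem_nhd (hA : A.IsSheaf) {W : Opens X} {i : ℤ} {N : ℕ} {t : A.sec W i}
    (h : ∀ x ∈ W, ∃ (V : Opens X) (hV : V ≤ W), x ∈ V ∧ A.res hV i t ∈ A.nhd N V i) :
    t ∈ A.nhd N W i := by
  choose V hV hxV hVt using fun x : {x : X // x ∈ W} => h x.1 x.2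
  exact hA.mem_nhd_of_eq (eq_iSup_of_forall_mem hV fun x hx => ⟨⟨x, hx⟩, hxV _⟩) hV hVt

theorem IsSheaf.eq_of_locally_eq (hA : A.IsSheaf) {W : Opens X} {i : ℤ} {t t' : A.sec W i}
    (h : ∀ x ∈ W, ∃ (V : Opens X) (hV : V ≤ W), x ∈ V ∧ A.res hV i t = A.res hV i t') :
    t = t' := by
  choose V hV hxV hVt using fun x : {x : X // x ∈ W} => h x.1 x.2
  refine (hA.existsUnique_glue_of_eq (eq_iSup_of_forall_mem hV fun x hx => ⟨⟨x, hx⟩, hxV _⟩) hV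
    (fun x => A.res (hV x) i t') fun x y => ?_).unique hVt fun x => rfl
  rw [A.res_res _ _ (inf_le_left.trans (hV x)), A.res_res]

/-- A property of sections which is local and determines the section uniquely is the property of
a section over `W` as soon as it is locally the property of some section. -/
theorem IsSheaf.exists_glue (hA : A.IsSheaf) {W : Opens X} {i : ℤ}
    (P : ∀ V : Opens X, A.sec V i → Prop)
    (hex : ∀ x ∈ W, ∃ (V : Opens X) (_ : V ≤ W) (t : A.sec V i), x ∈ V ∧ P V t)
    (hres : ∀ (V V' : Opens X) (h : V' ≤ V) (t : A.sec V i), P V t → P V' (A.res h i t))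
    (huniq : ∀ (V : Opens X) (t t' : A.sec V i), P V t → P V t' → t = t') :
    ∃ t : A.sec W i, ∀ x ∈ W, ∃ (V : Opens X) (hV : V ≤ W), x ∈ V ∧ P V (A.res hV i t) := by
  choose V hV s hxV hPs using fun x : {x : X // x ∈ W} => hex x.1 x.2
  obtain ⟨t, ht, -⟩ := hA.existsUnique_glue_of_eq
    (eq_iSup_of_forall_mem hV fun x hx => ⟨⟨x, hx⟩, hxV _⟩) hV s fun x y =>
      huniq _ _ _ (hres _ _ _ _ (hPs x)) (hres _ _ _ _ (hPs y))
  exact ⟨t, fun x hx => ⟨V ⟨x, hx⟩, hV _, hxV _, by rw [ht]; exact hPs _⟩⟩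

end Local

/-! ### Euler fields and their eigenvectors -/

section Euler

variable (A : GradedPresheaf.{u, v} X)

/-- The algebras of sections are Hausdorff and complete in their linear topology. -/
structure IsComplete : Prop where
  eq_zero : ∀ {W : Opens X} {i : ℤ} {a : A.sec W i}, (∀ N, a ∈ A.nhd N W i) → a = 0
  exists_limit : ∀ {W : Opens X} {i : ℤ} (b : ℕ → A.sec W i),
    (∀ m, b (m + 1) - b m ∈ A.nhd m W i) → ∃ t, ∀ m, t - b m ∈ A.nhd m W i

/-- A derivation of degree `0` of the sheaf of algebras which acts as the multiplication by `q` on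
the quotient of the `q`-th neighbourhood of zero by the next one. -/
structure EulerField where
  toLin : ∀ (W : Opens X) (i : ℤ), A.sec W i →ₗ[ℝ] A.sec W i
  leibniz : ∀ (W : Opens X) {i j k : ℤ} (h : i + j = k) (a : A.sec W i) (b : A.sec W j),
    toLin W k (A.mul W h a b) = A.mul W h (toLin W i a) b + A.mul W h a (toLin W j b)
  map_res : ∀ {U V : Opens X} (h : U ≤ V) (i : ℤ) (a : A.sec V i),
    toLin U i (A.res h i a) = A.res h i (toLin V i a)
  sub_smul_mem : ∀ {W : Opens X} {i : ℤ} {q : ℕ} {a : A.sec W i}, a ∈ A.nhd q W i →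
    toLin W i a - (q : ℝ) • a ∈ A.nhd (q + 1) W i

namespace EulerField

variable {A} (E : A.EulerField)

theorem map_one (W : Opens X) : E.toLin W 0 (A.one W) = 0 := by
  have := E.leibniz W (zero_add 0) (A.one W) (A.one W)
  rwa [A.one_mul, A.one_mul, A.mul_one', left_eq_add] at this

theorem mem_nhd {W : Opens X} {i : ℤ} {q : ℕ} {a : A.sec W i} (ha : a ∈ A.nhd q W i) :
    E.toLin W i a ∈ A.nhd q W i := by
  have := add_mem (A.nhd_succ _ _ _ (E.sub_smul_mem ha)) (Submodule.smul_mem _ (q : ℝ) ha)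
  rwa [sub_add_cancel] at this

/-- On the `q + 1`-st neighbourhood of zero, `q` is not an eigenvalue. -/
theorem eq_zero_of_eigen (hc : A.IsComplete) {W : Opens X} {i : ℤ} {q : ℕ} {a : A.sec W i}
    (ha : a ∈ A.nhd (q + 1) W i) (hE : E.toLin W i a = (q : ℝ) • a) : a = 0 := by
  have key : ∀ m, a ∈ A.nhd (q + 1 + m) W i := by
    intro m
    induction m with
    | zero => exact ha
    | succ m ih =>
      have h := E.sub_smul_mem ih
      rw [hE, ← sub_smul] at h
      refine (Submodule.smul_mem_iff _ ?_).1 h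
      push_cast
      have : (0 : ℝ) ≤ m := m.cast_nonneg
      exact ne_of_lt (by linarith)
  exact hc.eq_zero fun N => A.nhd_anti (by omega) W i (key N)

/-- Each class modulo the `q + 1`-st neighbourhood of zero of an element of the `q`-th
neighbourhood contains an eigenvector for the eigenvalue `q`. -/
theorem exists_eigen (hc : A.IsComplete) {W : Opens X} {i : ℤ} {q : ℕ} {a : A.sec W i}
    (ha : a ∈ A.nhd q W i) :
    ∃ b, b - a ∈ A.nhd (q + 1) W i ∧ E.toLin W i b = (q : ℝ) • b := by
  -- The approximations are corrected by `b ↦ b - (E - q) b / (m + 1)`: if `(E - q) b` lies in the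
  -- neighbourhood `q + m + 1`, then so does the correction, and since `E - q` acts as `m + 1` on
  -- the corresponding quotient, `(E - q) b` moves to the neighbourhood `q + m + 2`.
  let T : A.sec W i →ₗ[ℝ] A.sec W i := E.toLin W i - (q : ℝ) • LinearMap.id
  have hT : ∀ b, T b = E.toLin W i b - (q : ℝ) • b := fun b => rfl
  let b : ℕ → A.sec W i := fun m =>
    Nat.rec a (fun m b => b - ((m : ℝ) + 1)⁻¹ • T b) m
  have hb : ∀ m, b (m + 1) = b m - ((m : ℝ) + 1)⁻¹ • T (b m) := fun m => rfl
  have key : ∀ m, T (b m) ∈ A.nhd (q + m + 1) W i := by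
    intro m
    induction m with
    | zero => exact E.sub_smul_mem ha
    | succ m ih =>
      have h := E.sub_smul_mem ih
      have e : T (b (m + 1)) = -(((m : ℝ) + 1)⁻¹ •
          (E.toLin W i (T (b m)) - ((q + m + 1 : ℕ) : ℝ) • T (b m))) := by
        have hm : (m : ℝ) + 1 ≠ 0 := by positivity
        have e' : E.toLin W i (T (b m)) - ((q + m + 1 : ℕ) : ℝ) • T (b m) =
            T (T (b m)) - ((m : ℝ) + 1) • T (b m) := by
          rw [hT (T (b m)), sub_sub, ← add_smul]
          congr 2
          push_cast
          ring
        rw [e', hb, map_sub, map_smul, smul_sub, smul_smul, inv_mul_cancel₀ hm, one_smul, neg_sub]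
      rw [e]
      exact neg_mem (Submodule.smul_mem _ _ h)
  have hdiff : ∀ m, b (m + 1) - b m ∈ A.nhd (q + m + 1) W i := fun m => by
    rw [hb, sub_sub_cancel_left]
    exact neg_mem (Submodule.smul_mem _ _ (key m))
  obtain ⟨t, ht⟩ := hc.exists_limit b fun m => A.nhd_anti (by omega) W i (hdiff m)
  have hba : ∀ m, b m - a ∈ A.nhd (q + 1) W i := by
    intro m
    induction m with
    | zero => exact (sub_self a).symm ▸ zero_mem _
    | succ m ih =>
      have := add_mem (A.nhd_anti (by omega : q + 1 ≤ q + m + 1) W i (hdiff m)) ih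
      rwa [sub_add_sub_cancel] at this
  refine ⟨t, ?_, ?_⟩
  · have := add_mem (ht (q + 1)) (hba (q + 1))
    rwa [sub_add_sub_cancel] at this
  · rw [← sub_eq_zero, ← hT]
    refine hc.eq_zero fun N => ?_
    have h1 : T (t - b N) ∈ A.nhd N W i :=
      sub_mem (E.mem_nhd (ht N)) (Submodule.smul_mem _ _ (ht N))
    have := add_mem h1 (A.nhd_anti (by omega) W i (key N))
    rwa [← map_add, sub_add_cancel] at this

end EulerField

end Euler

/-! ### The splitting of the filtration by an Euler field -/

section Splitting

variable {A : GradedPresheaf.{u, v} X} (E : A.EulerField) (hc : A.IsComplete)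
  (hF : ∀ p W i, A.canFil p W i = A.nhd p W i)

theorem grMk_eq_grMk_iff {q : ℕ} {W : Opens X} {i : ℤ} {a b : A.canFil q W i} :
    A.grMk q W i a = A.grMk q W i b ↔ a.1 - b.1 ∈ A.canFil (q + 1) W i :=
  Submodule.Quotient.eq _

theorem canFil_zero (W : Opens X) (i : ℤ) : A.canFil 0 W i = ⊤ := by
  refine eq_top_iff.2 fun s _ x hx => ⟨W, le_rfl, hx, fun N => ?_⟩
  refine Submodule.mem_sup_left (Submodule.subset_span
    ⟨i, 0, add_zero i, A.res le_rfl i s, A.one W, by simp, ?_⟩)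
  rw [A.mul_one']

namespace EulerField

theorem existsUnique_lift (hc : A.IsComplete) (hF : ∀ p W i, A.canFil p W i = A.nhd p W i)
    {q : ℕ} {W : Opens X} {i : ℤ} (g : A.Gr q W i) :
    ∃! b : A.canFil q W i, A.grMk q W i b = g ∧ E.toLin W i b = (q : ℝ) • b.1 := by
  obtain ⟨a, rfl⟩ := Submodule.mkQ_surjective _ g
  obtain ⟨b, hb, hEb⟩ := E.exists_eigen hc (q := q) (a := a.1) (hF q W i ▸ a.2)
  have hbF : b ∈ A.canFil q W i := by
    have := add_mem (A.canFil_anti (Nat.le_succ q) W i (hF (q + 1) W i ▸ hb)) a.2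
    rwa [sub_add_cancel] at this
  refine ⟨⟨b, hbF⟩, ⟨grMk_eq_grMk_iff.2 (hF (q + 1) W i ▸ hb), hEb⟩, ?_⟩
  rintro c ⟨hc1, hEc⟩
  refine Subtype.ext (sub_eq_zero.1 (E.eq_zero_of_eigen hc (q := q) ?_ ?_))
  · rw [← hF]
    have h1 := grMk_eq_grMk_iff.1 hc1
    have h2 : b - a.1 ∈ A.canFil (q + 1) W i := hF (q + 1) W i ▸ hb
    have := sub_mem h1 h2
    rwa [sub_sub_sub_cancel_right] at this
  · rw [map_sub, hEc, hEb, smul_sub]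

/-- The splitting of `F^q → F^q / F^{q+1}` given by the eigenvectors for the eigenvalue `q`. -/
def split (q : ℕ) (W : Opens X) (i : ℤ) : A.Gr q W i →ₗ[ℝ] A.canFil q W i where
  toFun g := (E.existsUnique_lift hc hF g).choose
  map_add' g g' := by
    have h := (E.existsUnique_lift hc hF g).choose_spec.1
    have h' := (E.existsUnique_lift hc hF g').choose_spec.1
    refine ((E.existsUnique_lift hc hF (g + g')).choose_spec.2 _ ⟨?_, ?_⟩).symm
    · rw [map_add, h.1, h'.1]
    · rw [Submodule.coe_add, map_add, h.2, h'.2, smul_add]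
  map_smul' c g := by
    have h := (E.existsUnique_lift hc hF g).choose_spec.1
    refine ((E.existsUnique_lift hc hF (c • g)).choose_spec.2 _ ⟨?_, ?_⟩).symm
    · rw [map_smul, h.1, RingHom.id_apply]
    · rw [RingHom.id_apply, Submodule.coe_smul, map_smul, h.2, smul_comm]

variable {q : ℕ} {W : Opens X} {i : ℤ}

theorem grMk_split (g : A.Gr q W i) : A.grMk q W i (E.split hc hF q W i g) = g :=
  (E.existsUnique_lift hc hF g).choose_spec.1.1

theorem toLin_split (g : A.Gr q W i) :
    E.toLin W i (E.split hc hF q W i g) = (q : ℝ) • (E.split hc hF q W i g).1 :=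
  (E.existsUnique_lift hc hF g).choose_spec.1.2

theorem eq_split {g : A.Gr q W i} {b : A.canFil q W i} (h : A.grMk q W i b = g)
    (h' : E.toLin W i b = (q : ℝ) • b.1) : b = E.split hc hF q W i g :=
  (E.existsUnique_lift hc hF g).choose_spec.2 b ⟨h, h'⟩

/-- The eigenvectors multiply like the classes, as the eigenvalues of a derivation add up. -/
theorem split_grMul {p q r : ℕ} (hr : p + q = r) {j k : ℤ} (h : i + j = k) (a : A.Gr p W i)
    (b : A.Gr q W j) : (E.split hc hF r W k (A.grMul hr W h a b)).1 =
      A.mul W h (E.split hc hF p W i a) (E.split hc hF q W j b) := by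
  have := E.eq_split hc hF (g := A.grMul hr W h a b)
    (b := ⟨A.mul W h (E.split hc hF p W i a) (E.split hc hF q W j b),
      A.mul_mem_canFil hr h (E.split hc hF p W i a).2 (E.split hc hF q W j b).2⟩) ?_ ?_
  · rw [← this]
  · rw [← A.grMul_mk, grMk_split, grMk_split]
  · subst hr
    rw [E.leibniz, toLin_split, toLin_split, map_smul, map_smul, LinearMap.smul_apply, ← add_smul,
      Nat.cast_add]

theorem split_grRes {U : Opens X} (h : U ≤ W) (a : A.Gr q W i) :
    (E.split hc hF q U i (A.grRes q h i a)).1 = A.res h i (E.split hc hF q W i a) := by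
  have := E.eq_split hc hF (g := A.grRes q h i a)
    (b := ⟨A.res h i (E.split hc hF q W i a), A.res_mem_canFil h (E.split hc hF q W i a).2⟩) ?_ ?_
  · rw [← this]
  · rw [← A.grRes_mk, grMk_split]
  · rw [E.map_res, toLin_split, map_smul]

theorem split_one (W : Opens X) :
    (E.split hc hF 0 W 0 (A.grMk 0 W 0 ⟨A.one W, A.one_mem_canFil W⟩)).1 = A.one W := by
  rw [← E.eq_split hc hF (b := ⟨A.one W, A.one_mem_canFil W⟩) rfl]
  rw [E.map_one, Nat.cast_zero, zero_smul]

/-- The section `t` is the sum of the series of the eigenvectors which represent the classes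
`a q`. -/
def IsSum (a : ∀ q, A.Gr q W i) (t : A.sec W i) : Prop :=
  ∀ N, t - ∑ q ∈ Finset.range N, (E.split hc hF q W i (a q)).1 ∈ A.nhd N W i

theorem existsUnique_isSum (a : ∀ q, A.Gr q W i) : ∃! t, E.IsSum hc hF a t := by
  obtain ⟨t, ht⟩ := hc.exists_limit
    (fun N => ∑ q ∈ Finset.range N, (E.split hc hF q W i (a q)).1) fun N => by
      rw [Finset.sum_range_succ, add_sub_cancel_left, ← hF]
      exact (E.split hc hF N W i (a N)).2
  refine ⟨t, ht, fun t' ht' => sub_eq_zero.1 (hc.eq_zero fun N => ?_)⟩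
  have := sub_mem (ht' N) (ht N)
  rwa [sub_sub_sub_cancel_right] at this

/-- The sum of the series of the eigenvectors which represent the classes `a q`. -/
def sum (W : Opens X) (i : ℤ) : (∀ q, A.Gr q W i) →ₗ[ℝ] A.sec W i where
  toFun a := (E.existsUnique_isSum hc hF a).choose
  map_add' a b := by
    have h := (E.existsUnique_isSum hc hF a).choose_spec.1
    have h' := (E.existsUnique_isSum hc hF b).choose_spec.1
    refine ((E.existsUnique_isSum hc hF (a + b)).choose_spec.2 _ fun N => ?_).symm
    have := add_mem (h N) (h' N)
    rw [← add_sub_add_comm, ← Finset.sum_add_distrib] at this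
    simpa only [Pi.add_apply, map_add, Submodule.coe_add] using this
  map_smul' c a := by
    have h := (E.existsUnique_isSum hc hF a).choose_spec.1
    refine ((E.existsUnique_isSum hc hF (c • a)).choose_spec.2 _ fun N => ?_).symm
    have := Submodule.smul_mem _ c (h N)
    rw [smul_sub, Finset.smul_sum] at this
    simpa only [Pi.smul_apply, map_smul, Submodule.coe_smul, RingHom.id_apply] using this

theorem isSum_sum (a : ∀ q, A.Gr q W i) : E.IsSum hc hF a (E.sum hc hF W i a) :=
  (E.existsUnique_isSum hc hF a).choose_spec.1

theorem IsSum.eq_sum {a : ∀ q, A.Gr q W i} {t : A.sec W i} (h : E.IsSum hc hF a t) :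
    t = E.sum hc hF W i a :=
  (E.existsUnique_isSum hc hF a).choose_spec.2 t h

theorem sum_mem_nhd_iff {N : ℕ} {a : ∀ q, A.Gr q W i} :
    E.sum hc hF W i a ∈ A.nhd N W i ↔ ∀ q < N, a q = 0 := by
  have hs := E.isSum_sum hc hF a
  constructor
  · intro h q
    induction q using Nat.strong_induction_on with
    | _ q ih =>
      intro hq
      have h1 := sub_mem (A.nhd_anti (Nat.succ_le_iff.2 hq) W i h) (hs (q + 1))
      rw [sub_sub_cancel, Finset.sum_range_succ, Finset.sum_eq_zero, zero_add, ← hF] at h1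
      · rw [← E.grMk_split hc hF (a q)]
        exact A.grMk_eq_zero h1
      · intro r hr
        rw [ih r (Finset.mem_range.1 hr) ((Finset.mem_range.1 hr).trans hq), map_zero]
        rfl
  · intro h
    have h1 := hs N
    rwa [Finset.sum_eq_zero, sub_zero] at h1
    intro q hq
    rw [h q (Finset.mem_range.1 hq), map_zero]
    rfl

theorem sum_injective : Function.Injective (E.sum hc hF W i) := by
  refine (injective_iff_map_eq_zero _).2 fun a ha => funext fun q => ?_
  exact (E.sum_mem_nhd_iff hc hF (N := q + 1)).1 (ha ▸ zero_mem _) q (Nat.lt_succ_self q)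

theorem sum_surjective : Function.Surjective (E.sum hc hF W i) := by
  intro t
  -- The remainder `r q ∈ F^q` is left after the removal of the eigenvectors of eigenvalue `< q`.
  have step : ∀ q (r : A.canFil q W i),
      r.1 - (E.split hc hF q W i (A.grMk q W i r)).1 ∈ A.canFil (q + 1) W i := fun q r =>
    grMk_eq_grMk_iff.1 (E.grMk_split hc hF _).symm
  let r : ∀ q, A.canFil q W i := fun q => Nat.rec (motive := fun q => A.canFil q W i)
    ⟨t, by rw [canFil_zero]; trivial⟩ (fun q r => ⟨_, step q r⟩) q
  have hr : ∀ q, (r (q + 1)).1 = (r q).1 - (E.split hc hF q W i (A.grMk q W i (r q))).1 :=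
    fun q => rfl
  have key : ∀ N, (r N).1 =
      t - ∑ q ∈ Finset.range N, (E.split hc hF q W i (A.grMk q W i (r q))).1 := by
    intro N
    induction N with
    | zero => exact (sub_zero t).symm
    | succ N ih => rw [hr, ih, Finset.sum_range_succ, sub_sub]
  refine ⟨fun q => A.grMk q W i (r q), (IsSum.eq_sum E hc hF fun N => ?_).symm⟩
  rw [← key, ← hF]
  exact (r N).2

theorem sum_barOne (W : Opens X) : E.sum hc hF W 0 (A.barOne W) = A.one W := by
  refine (IsSum.eq_sum E hc hF fun N => ?_).symm
  cases N with
  | zero => rw [← hF, canFil_zero]; trivial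
  | succ N =>
    have h0 : ∀ q, (E.split hc hF (q + 1) W 0 (A.barOne W (q + 1))).1 = 0 := fun q => by
      rw [show A.barOne W (q + 1) = 0 from rfl, map_zero]
      rfl
    have h1 : (E.split hc hF 0 W 0 (A.barOne W 0)).1 = A.one W := E.split_one hc hF W
    rw [Finset.sum_range_succ', h1, Finset.sum_eq_zero fun q _ => h0 q, zero_add, sub_self]
    exact zero_mem _

theorem sum_barMul {j k : ℤ} (h : i + j = k) (a : ∀ q, A.Gr q W i) (b : ∀ q, A.Gr q W j) :
    E.sum hc hF W k (A.barMul W h a b) = A.mul W h (E.sum hc hF W i a) (E.sum hc hF W j b) := by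
  refine (IsSum.eq_sum E hc hF fun N => ?_).symm
  set x := fun q => (E.split hc hF q W i (a q)).1
  set y := fun q => (E.split hc hF q W j (b q)).1
  have hab : ∀ q, (E.split hc hF q W k (A.barMul W h a b q)).1 =
      ∑ z ∈ Finset.HasAntidiagonal.antidiagonal q, A.mul W h (x z.1) (y z.2) := by
    intro q
    have e : A.barMul W h a b q = ∑ x : Finset.HasAntidiagonal.antidiagonal q,
      A.grMul (Finset.HasAntidiagonal.mem_antidiagonal.1 x.2) W h (a x.1.1) (b x.1.2) := rfl
    rw [e, map_sum, AddSubmonoidClass.coe_finsetSum,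
      ← Finset.sum_coe_sort (Finset.HasAntidiagonal.antidiagonal q)]
    exact Finset.sum_congr rfl fun z _ => E.split_grMul hc hF _ h _ _
  have hx := E.isSum_sum hc hF a N
  have hy := E.isSum_sum hc hF b N
  -- The partial sum of the product series consists of the products `x p * y q` with `p + q < N`;
  -- in the product of the partial sums, the remaining products are in the `N`-th neighbourhood.
  have hrest : A.mul W h (∑ q ∈ Finset.range N, x q) (∑ q ∈ Finset.range N, y q) -
      ∑ q ∈ Finset.range N, ∑ z ∈ Finset.HasAntidiagonal.antidiagonal q,
        A.mul W h (x z.1) (y z.2) ∈ A.nhd N W k := by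
    have e1 : A.mul W h (∑ q ∈ Finset.range N, x q) (∑ q ∈ Finset.range N, y q) =
        ∑ z ∈ Finset.range N ×ˢ Finset.range N, A.mul W h (x z.1) (y z.2) := by
      rw [Finset.sum_product_right]
      simp only [map_sum, LinearMap.sum_apply]
    have e2 : ∑ q ∈ Finset.range N, ∑ z ∈ Finset.HasAntidiagonal.antidiagonal q,
        A.mul W h (x z.1) (y z.2) =
        ∑ z ∈ Finset.range N ×ˢ Finset.range N with z.1 + z.2 < N, A.mul W h (x z.1) (y z.2) := by
      rw [Finset.sum_sigma']
      refine Finset.sum_nbij' (fun z => z.2) (fun z => ⟨z.1 + z.2, z⟩) ?_ ?_ ?_ ?_ ?_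
      · rintro ⟨q, z⟩ hz
        simp only [Finset.mem_sigma, Finset.mem_range, Finset.HasAntidiagonal.mem_antidiagonal] at hz
        simp only [Finset.mem_filter, Finset.mem_product, Finset.mem_range]
        omega
      · rintro z hz
        simp only [Finset.mem_filter, Finset.mem_product, Finset.mem_range] at hz
        simp only [Finset.mem_sigma, Finset.mem_range, Finset.HasAntidiagonal.mem_antidiagonal, and_true]
        exact hz.2
      · rintro ⟨q, z⟩ hz
        simp only [Finset.mem_sigma, Finset.mem_range, Finset.HasAntidiagonal.mem_antidiagonal] at hz
        obtain ⟨-, rfl⟩ := hz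
        rfl
      · exact fun _ _ => rfl
      · exact fun _ _ => rfl
    rw [e1, e2, ← Finset.sum_filter_add_sum_filter_not _ (fun z => z.1 + z.2 < N),
      add_sub_cancel_left]
    refine Submodule.sum_mem _ fun z hz => ?_
    have hN := (Finset.mem_filter.1 hz).2
    refine A.nhd_anti (not_lt.1 hN) W k ?_
    rw [← hF]
    exact A.mul_mem_canFil rfl h (E.split hc hF _ W i _).2 (E.split hc hF _ W j _).2
  rw [Finset.sum_congr rfl fun q _ => hab q]
  have h1 := A.mul_mem_nhd' h _ (E.sum hc hF W j b) hx
  have h2 := A.mul_mem_nhd h (∑ q ∈ Finset.range N, x q) _ hy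
  rw [map_sub, LinearMap.sub_apply] at h1
  rw [map_sub] at h2
  have := add_mem (add_mem h1 h2) hrest
  rwa [sub_add_sub_cancel, sub_add_sub_cancel] at this

theorem sum_res {U : Opens X} (h : U ≤ W) (a : ∀ q, A.Gr q W i) :
    E.sum hc hF U i (fun q => A.grRes q h i (a q)) = A.res h i (E.sum hc hF W i a) := by
  refine (IsSum.eq_sum E hc hF fun N => ?_).symm
  have := A.res_mem_nhd h _ (E.isSum_sum hc hF a N)
  rw [map_sub, map_sum] at this
  rwa [Finset.sum_congr rfl fun q _ => E.split_grRes hc hF h (a q)]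

/-- The isomorphism of the completed associated graded algebra with the structure sheaf which is
given by the eigenspaces of the Euler field. -/
def barIso : Iso A.bar A where
  equiv W _ i := LinearEquiv.ofBijective (E.sum hc hF W i)
    ⟨E.sum_injective hc hF, E.sum_surjective hc hF⟩
  map_one W _ := E.sum_barOne hc hF W
  map_mul _ _ _ _ _ h a b := E.sum_barMul hc hF h a b
  map_res _ _ _ _ h _ a := E.sum_res hc hF h a
  mem_nhd_iff _ _ _ _ _ := E.sum_mem_nhd_iff hc hF

end EulerField

end Splitting

end GradedPresheaf

/-! ### Gluing of Euler fields -/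

namespace GradedPresheaf

section GlueEuler

variable {X : Type u} [TopologicalSpace X] {A : GradedPresheaf.{u, v} X}

/-- An Euler field may be defined on the open sets of a basis of the topology which is stable under
passage to smaller open sets. -/
theorem IsSheaf.nonempty_eulerField (hA : A.IsSheaf) (S : Opens X → Prop)
    (hS : ∀ (W : Opens X), ∀ x ∈ W, ∃ V ≤ W, x ∈ V ∧ S V)
    (hanti : ∀ V V' : Opens X, V' ≤ V → S V → S V')
    (D : ∀ (V : Opens X) (i : ℤ), A.sec V i →ₗ[ℝ] A.sec V i)
    (leibniz : ∀ V, S V → ∀ {i j k : ℤ} (h : i + j = k) (a : A.sec V i) (b : A.sec V j),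
      D V k (A.mul V h a b) = A.mul V h (D V i a) b + A.mul V h a (D V j b))
    (map_res : ∀ (V V' : Opens X) (h : V' ≤ V), S V → ∀ (i : ℤ) (a : A.sec V i),
      D V' i (A.res h i a) = A.res h i (D V i a))
    (sub_smul_mem : ∀ V, S V → ∀ {i : ℤ} {q : ℕ} {a : A.sec V i}, a ∈ A.nhd q V i →
      D V i a - (q : ℝ) • a ∈ A.nhd (q + 1) V i) : Nonempty A.EulerField := by
  have key : ∀ (W : Opens X) (i : ℤ) (a : A.sec W i), ∃ t : A.sec W i,
      ∀ (V : Opens X) (hV : V ≤ W), S V → A.res hV i t = D V i (A.res hV i a) := by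
    intro W i a
    obtain ⟨t, ht⟩ : ∃ t : A.sec W i, ∀ x ∈ W, ∃ (V : Opens X) (hV : V ≤ W), x ∈ V ∧
        ∃ hV' : V ≤ W, ∀ (V' : Opens X) (h : V' ≤ V), S V' →
          A.res h i (A.res hV i t) = D V' i (A.res (h.trans hV') i a) := by
      refine hA.exists_glue (fun V t => ∃ hV : V ≤ W, ∀ (V' : Opens X) (h : V' ≤ V), S V' →
        A.res h i t = D V' i (A.res (h.trans hV) i a)) ?_ ?_ ?_
      · intro x hx
        obtain ⟨V, hV, hxV, hSV⟩ := hS W x hx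
        refine ⟨V, hV, D V i (A.res hV i a), hxV, hV, fun V' h _ => ?_⟩
        rw [← map_res _ _ _ hSV, A.res_res]
      · rintro V V' h t ⟨hV, ht⟩
        refine ⟨h.trans hV, fun V'' h' hS'' => ?_⟩
        rw [A.res_res _ _ (h'.trans h), ht _ _ hS'']
      · rintro V t t' ⟨hV, ht⟩ ⟨_, ht'⟩
        refine hA.eq_of_locally_eq fun x hx => ?_
        obtain ⟨V', hV', hxV', hSV'⟩ := hS V x hx
        exact ⟨V', hV', hxV', (ht _ hV' hSV').trans (ht' _ hV' hSV').symm⟩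
    refine ⟨t, fun V hV hSV => hA.eq_of_locally_eq fun x hx => ?_⟩
    obtain ⟨V', hV', hxV', hVW, h⟩ := ht x (hV hx)
    refine ⟨V ⊓ V', inf_le_left, ⟨hx, hxV'⟩, ?_⟩
    have h1 := h (V ⊓ V') inf_le_right (hanti _ _ inf_le_left hSV)
    rw [A.res_res _ _ (inf_le_left.trans hV)] at h1
    rw [A.res_res _ _ (inf_le_left.trans hV), h1, ← map_res _ _ _ hSV, A.res_res]
  have ext : ∀ {W : Opens X} {i : ℤ} {t t' : A.sec W i},
      (∀ (V : Opens X) (hV : V ≤ W), S V → A.res hV i t = A.res hV i t') → t = t' := by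
    intro W i t t' h
    refine hA.eq_of_locally_eq fun x hx => ?_
    obtain ⟨V, hV, hxV, hSV⟩ := hS W x hx
    exact ⟨V, hV, hxV, h V hV hSV⟩
  choose T hT using key
  refine ⟨{ toLin := fun W i => { toFun := T W i, map_add' := ?_, map_smul' := ?_ },
            leibniz := ?_, map_res := ?_, sub_smul_mem := ?_ }⟩
  · intro a b
    refine ext fun V hV hSV => ?_
    rw [hT _ _ _ V hV hSV, map_add, map_add, map_add, hT _ _ _ V hV hSV, hT _ _ _ V hV hSV]
  · intro c a
    refine ext fun V hV hSV => ?_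
    rw [hT _ _ _ V hV hSV, map_smul, map_smul, map_smul, hT _ _ _ V hV hSV, RingHom.id_apply]
  · intro W i j k h a b
    refine ext fun V hV hSV => ?_
    change A.res hV k (T _ _ _) = A.res hV k (A.mul W h (T _ _ _) b + A.mul W h a (T _ _ _))
    rw [hT _ _ _ V hV hSV, A.res_mul, leibniz V hSV, map_add, A.res_mul, A.res_mul,
      hT _ _ _ V hV hSV, hT _ _ _ V hV hSV]
  · intro U W h i a
    refine ext fun V hV hSV => ?_
    change A.res hV i (T _ _ _) = A.res hV i (A.res h i (T _ _ _))
    rw [hT _ _ _ V hV hSV, A.res_res _ _ (hV.trans h), A.res_res _ _ (hV.trans h),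
      hT _ _ _ V _ hSV]
  · intro W i q a ha
    refine hA.mem_nhd fun x hx => ?_
    obtain ⟨V, hV, hxV, hSV⟩ := hS W x hx
    refine ⟨V, hV, hxV, ?_⟩
    change A.res hV i (T _ _ _ - _) ∈ _
    rw [map_sub, hT _ _ _ V hV hSV, map_smul]
    exact sub_smul_mem V hSV (A.res_mem_nhd hV a ha)

end GlueEuler

end GradedPresheaf

/-! ### Charts -/

section Charts

open GradedPresheaf

variable {n : ℕ} {X : Type u} [TopologicalSpace X] [ChartedSpace (EuclideanSpace ℝ (Fin n)) X]

namespace localModel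

variable {d : ℤ → ℕ} {W : Opens X} {i : ℤ}

theorem mem_nhd_of_le {p : ℕ} (h : i ≤ -(p : ℤ)) (a : (localModel n X d).sec W i) :
    a ∈ (localModel n X d).nhd p W i :=
  limSym.mem_nhd_of_le h a

theorem isComplete : (localModel n X d).IsComplete where
  eq_zero h := limSym.eq_zero_of_forall_mem_nhd h
  exists_limit b hb := limSym.exists_limit b hb

/-- In the local model, the `p`-th neighbourhood of zero is contained in the closure of the ideal
generated by the elements of degree `≤ -p`. -/
theorem nhd_le {p : ℕ} (N : ℕ) : (localModel n X d).nhd p W i ≤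
    (localModel n X d).idealLE p W i ⊔ (localModel n X d).nhd N W i := by
  intro (a : limSym (Smooth n X W) d i) ha
  obtain ⟨s, hs, hsa⟩ := a.2.1 (max p N)
  have hsp : s ∈ GSym.fil _ d p := by
    rw [← Ideal.Quotient.eq_zero_iff_mem, ← limSym.mem_nhd.1 ha,
      ← a.2.2 p (max p N) (le_max_left _ _), ← hsa]
    rfl
  have h2 : a - limSym.ofSym s hs ∈ limSym.nhd (Smooth n X W) d N i :=
    limSym.nhd_le_nhd (le_max_right p N) i (sub_eq_zero.2 hsa.symm)
  exact Submodule.mem_sup.2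
    ⟨limSym.ofSym s hs, limSym.ofSym_mem_span hs hsp, _, h2, add_sub_cancel _ _⟩

variable (d) in
/-- The inclusion of the smooth functions of the base in the functions of the local model. -/
def ofBase (W : Opens X) : Smooth n X W →ₗ[ℝ] (localModel n X d).sec W 0 :=
  limSym.ofBase

theorem ofBase_one : ofBase d W (1 : Smooth n X W) = (localModel n X d).one W :=
  limSym.ofBase_one

theorem ofBase_mul (f g : Smooth n X W) :
    ofBase d W (f * g) = (localModel n X d).mul W (zero_add 0) (ofBase d W f) (ofBase d W g) :=
  limSym.ofBase_mul (zero_add 0) f g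

theorem res_ofBase {V : Opens X} (h : V ≤ W) (f : Smooth n X W) :
    (localModel n X d).res h 0 (ofBase d W f) = ofBase d V (smoothRes n X h f) :=
  limSym.map_ofBase _ f

/-- The smooth function on the base which underlies a function of degree `0`. -/
def body : (localModel n X d).sec W 0 →ₗ[ℝ] Smooth n X W :=
  limSym.body

theorem body_one : body ((localModel n X d).one W) = 1 :=
  limSym.body_one

theorem body_mul (a b : (localModel n X d).sec W 0) :
    body ((localModel n X d).mul W (zero_add 0) a b) = body a * body b :=
  limSym.body_mul (zero_add 0) a b

theorem body_res {V : Opens X} (h : V ≤ W) (a : (localModel n X d).sec W 0) :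
    body ((localModel n X d).res h 0 a) = smoothRes n X h (body a) :=
  limSym.body_map _ a

theorem sub_ofBase_body_mem_nhd (hd : d 0 = 0) (a : (localModel n X d).sec W 0) :
    a - ofBase d W (body a) ∈ (localModel n X d).nhd 1 W 0 :=
  limSym.sub_ofBase_body_mem_nhd hd a

/-- The product of a smooth function `g` of the base with the derivation of the local model which
multiplies a monomial by the absolute value of the total degree of its factors of negative
degree. -/
def euler (g : Smooth n X W) (i : ℤ) :
    (localModel n X d).sec W i →ₗ[ℝ] (localModel n X d).sec W i :=
  limSym.diag (fun w => (w.2 : ℝ) • g) i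

theorem euler_zero (a : (localModel n X d).sec W i) : euler 0 i a = 0 := by
  have : (fun w : ℤ × ℕ => (w.2 : ℝ) • (0 : Smooth n X W)) = 0 := funext fun w => smul_zero _
  unfold euler
  rw [this]
  exact limSym.diag_zero i a

theorem euler_mul (g : Smooth n X W) {j k : ℤ} (h : i + j = k) (a : (localModel n X d).sec W i)
    (b : (localModel n X d).sec W j) :
    euler g k ((localModel n X d).mul W h a b) =
      (localModel n X d).mul W h (euler g i a) b + (localModel n X d).mul W h a (euler g j b) :=
  limSym.diag_mul (fun w w' => by rw [Prod.snd_add, Nat.cast_add, add_smul]) h a b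

theorem res_euler {V : Opens X} (h : V ≤ W) (g : Smooth n X W) (a : (localModel n X d).sec W i) :
    (localModel n X d).res h i (euler g i a) =
      euler (smoothRes n X h g) i ((localModel n X d).res h i a) := by
  have e : (fun w : ℤ × ℕ => smoothRes n X h ((w.2 : ℝ) • g)) =
      fun w => (w.2 : ℝ) • smoothRes n X h g := funext fun w => map_smul _ _ _
  unfold euler
  rw [← e]
  exact limSym.map_diag _ _ i a

theorem euler_sub_mem_nhd (g : Smooth n X W) {q : ℕ} {a : (localModel n X d).sec W i}
    (ha : a ∈ (localModel n X d).nhd q W i) :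
    euler g i a - (q : ℝ) • (localModel n X d).mul W (zero_add i) (ofBase d W g) a ∈
      (localModel n X d).nhd (q + 1) W i := by
  rw [← LinearMap.smul_apply, ← map_smul, ← map_smul]
  exact limSym.diag_sub_mem_nhd (fun w hw => by rw [hw]) (zero_add i) ha

end localModel

open localModel in
/-- An isomorphism of local models over the identity of the base is the identity on the functions
of the base: if the value at `x` of the image of `f` is `c ≠ f x`, then `f - c` is invertible near
`x`, hence so is its image, whose value at `x` is `0`. -/
theorem body_equiv_ofBase {d d' : ℤ → ℕ} {U : Opens X}
    (e : IsoOn U (localModel n X d) (localModel n X d')) {W : Opens X} (hW : W ≤ U)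
    (f : Smooth n X W) : body (e.equiv W hW 0 (ofBase d W f)) = f := by
  set f' := body (e.equiv W hW 0 (ofBase d W f)) with hf'
  ext x
  by_contra hne
  let c : ℝ := f' x
  let V : Opens X := ⟨Subtype.val '' {y : W | f y ≠ c}, W.isOpen.isOpenMap_subtype_val _
    (isOpen_ne_fun f.contMDiff.continuous continuous_const)⟩
  have hVW : V ≤ W := by
    rintro _ ⟨y, -, rfl⟩
    exact y.2
  have hxV : (x : X) ∈ V := ⟨x, fun h => hne h.symm, rfl⟩
  let g : Smooth n X V := smoothRes n X hVW f - algebraMap ℝ _ c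
  have hg : ∀ y : V, g y ≠ 0 := by
    rintro ⟨_, y, hy, rfl⟩
    exact sub_ne_zero.2 hy
  let h : Smooth n X V := ⟨fun y => (g y)⁻¹, g.contMDiff.inv₀ hg⟩
  have hgh : g * h = 1 := by
    ext y
    exact mul_inv_cancel₀ (hg y)
  have hVU := hVW.trans hW
  have e1 : body (e.equiv V hVU 0 (ofBase d V g)) =
      smoothRes n X hVW f' - algebraMap ℝ _ c := by
    rw [map_sub, ← res_ofBase, Algebra.algebraMap_eq_smul_one, map_smul, ofBase_one, map_sub,
      map_smul, e.map_one, e.map_res V W hVU hW, map_sub, map_smul, body_one, body_res]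
  have e2 : body (e.equiv V hVU 0 (ofBase d V g)) * body (e.equiv V hVU 0 (ofBase d V h)) = 1 := by
    rw [← body_mul, ← e.map_mul, ← ofBase_mul, hgh, ofBase_one, e.map_one, body_one]
  have e3 : (f' x - c) * body (e.equiv V hVU 0 (ofBase d V h)) ⟨x, hxV⟩ = 1 := by
    rw [e1] at e2
    exact congrArg (fun g : Smooth n X V => g ⟨x, hxV⟩) e2
  rw [sub_self, zero_mul] at e3
  exact zero_ne_one e3

namespace IsGradedManifold

variable {M : GradedPresheaf.{u, v} X}

theorem exists_chart (hM : IsGradedManifold n M) {W : Opens X} {x : X} (hx : x ∈ W) :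
    ∃ V ≤ W, x ∈ V ∧ ∃ d : ℤ → ℕ, Nonempty (IsoOn V M (localModel n X d)) := by
  obtain ⟨U, hxU, d, -, ⟨e⟩⟩ := hM.locally_model x
  exact ⟨W ⊓ U, inf_le_left, ⟨hx, hxU⟩, d, ⟨e.mono inf_le_right⟩⟩

theorem of_iso {B : GradedPresheaf.{u, w} X} (hM : IsGradedManifold n M) (e : Iso M B) :
    IsGradedManifold n B where
  isSheaf := hM.isSheaf.of_iso e
  locally_model x := by
    obtain ⟨U, hxU, d, hd, ⟨e'⟩⟩ := hM.locally_model x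
    exact ⟨U, hxU, d, hd, ⟨(e.mono le_top).symm.trans e'⟩⟩

theorem eq_zero_of_forall_mem_nhd (hM : IsGradedManifold n M) {W : Opens X} {i : ℤ}
    {a : M.sec W i} (ha : ∀ N, a ∈ M.nhd N W i) : a = 0 := by
  refine hM.isSheaf.eq_of_locally_eq fun x hx => ?_
  obtain ⟨V, hV, hxV, d, ⟨e⟩⟩ := hM.exists_chart hx
  refine ⟨V, hV, hxV, ?_⟩
  rw [map_zero, ← (e.equiv V le_rfl i).map_eq_zero_iff]
  refine localModel.isComplete.eq_zero fun N => ?_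
  rw [e.mem_nhd_iff]
  exact M.res_mem_nhd hV a (ha N)

theorem isComplete (hM : IsGradedManifold n M) : M.IsComplete where
  eq_zero := hM.eq_zero_of_forall_mem_nhd
  exists_limit {W i} b hb := by
    obtain ⟨t, ht⟩ : ∃ t : M.sec W i, ∀ x ∈ W, ∃ (V : Opens X) (hV : V ≤ W), x ∈ V ∧
        ∃ hV' : V ≤ W, ∀ m, M.res hV i t - M.res hV' i (b m) ∈ M.nhd m V i := by
      refine hM.isSheaf.exists_glue (fun V t => ∃ hV : V ≤ W, ∀ m,
        t - M.res hV i (b m) ∈ M.nhd m V i) ?_ ?_ ?_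
      · intro x hx
        obtain ⟨V, hV, hxV, d, ⟨e⟩⟩ := hM.exists_chart hx
        obtain ⟨t, ht⟩ := localModel.isComplete.exists_limit
          (fun m => e.equiv V le_rfl i (M.res hV i (b m))) fun m => by
            rw [← map_sub, ← map_sub, e.mem_nhd_iff]
            exact M.res_mem_nhd hV _ (hb m)
        refine ⟨V, hV, (e.equiv V le_rfl i).symm t, hxV, hV, fun m => ?_⟩
        rw [← e.mem_nhd_iff V le_rfl, map_sub, LinearEquiv.apply_symm_apply]
        exact ht m
      · rintro V V' h t ⟨hV, ht⟩
        refine ⟨h.trans hV, fun m => ?_⟩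
        rw [← M.res_res h hV, ← map_sub]
        exact M.res_mem_nhd h _ (ht m)
      · rintro V t t' ⟨hV, ht⟩ ⟨_, ht'⟩
        refine sub_eq_zero.1 (hM.eq_zero_of_forall_mem_nhd fun N => ?_)
        have := sub_mem (ht N) (ht' N)
        rwa [sub_sub_sub_cancel_right] at this
    refine ⟨t, fun m => hM.isSheaf.mem_nhd fun x hx => ?_⟩
    obtain ⟨V, hV, hxV, _, h⟩ := ht x hx
    exact ⟨V, hV, hxV, by rw [map_sub]; exact h m⟩

/-- The canonical filtration consists of the basic neighbourhoods of zero. -/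
theorem canFil_eq_nhd (hM : IsGradedManifold n M) (p : ℕ) (W : Opens X) (i : ℤ) :
    M.canFil p W i = M.nhd p W i := by
  apply le_antisymm
  · have hle : ∀ (V : Opens X) (i : ℤ), M.idealLE p V i ≤ M.nhd p V i := by
      refine fun V i => Submodule.span_le.2 ?_
      rintro _ ⟨j, k, hjk, a, b, hk, rfl⟩
      refine M.mul_mem_nhd hjk a b (hM.isSheaf.mem_nhd fun x hx => ?_)
      obtain ⟨V', hV', hxV', d, ⟨e⟩⟩ := hM.exists_chart hx
      refine ⟨V', hV', hxV', ?_⟩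
      rw [← e.mem_nhd_iff V' le_rfl]
      exact localModel.mem_nhd_of_le hk _
    intro a ha
    refine hM.isSheaf.mem_nhd fun x hx => ?_
    obtain ⟨V, hV, hxV, h⟩ := ha x hx
    exact ⟨V, hV, hxV, sup_le (hle V i) le_rfl (h p)⟩
  · intro a ha x hx
    obtain ⟨V, hV, hxV, d, ⟨e⟩⟩ := hM.exists_chart hx
    refine ⟨V, hV, hxV, fun N => ?_⟩
    have h := localModel.nhd_le N ((e.mem_nhd_iff V le_rfl p i _).2 (M.res_mem_nhd hV a ha))
    obtain ⟨y, hy, z, hz, hyz⟩ := Submodule.mem_sup.1 h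
    rw [← (e.equiv V le_rfl i).symm_apply_apply (M.res hV i a), ← hyz, map_add]
    exact Submodule.add_mem_sup (e.symm.mem_idealLE le_rfl hy)
      ((e.symm.mem_nhd_iff V le_rfl N i z).2 hz)

end IsGradedManifold

end Charts

/-! ### Existence of an Euler field -/

section EulerField

open GradedPresheaf

variable {n : ℕ} {X : Type u} [TopologicalSpace X] [ChartedSpace (EuclideanSpace ℝ (Fin n)) X]

/-- The restriction to an open set of a smooth function on the whole base. -/
def smoothRestrict (g : C^∞⟮𝓡 n, X; ℝ⟯) (V : Opens X) : Smooth n X V :=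
  ⟨fun x => g x, g.contMDiff.comp contMDiff_subtype_val⟩

variable {M : GradedPresheaf.{u, v} X}

namespace GradedPresheaf.IsoOn

variable {U : Opens X} {d : ℤ → ℕ} (e : IsoOn U M (localModel n X d)) (g : C^∞⟮𝓡 n, X; ℝ⟯)

open Classical in
/-- The derivation `localModel.euler`, multiplied by a smooth function `g`, in a chart over `U`;
zero on the open sets which are not contained in `U`. -/
def euler (V : Opens X) (i : ℤ) : M.sec V i →ₗ[ℝ] M.sec V i :=
  if h : V ≤ U then (e.equiv V h i).symm.toLinearMap ∘ₗ
    localModel.euler (smoothRestrict g V) i ∘ₗ (e.equiv V h i).toLinearMap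
  else 0

open Classical in
/-- The section of degree `0` which corresponds to a smooth function `g` in a chart over `U`;
zero on the open sets which are not contained in `U`. -/
def ofBase (V : Opens X) : M.sec V 0 :=
  if h : V ≤ U then (e.equiv V h 0).symm (localModel.ofBase d V (smoothRestrict g V)) else 0

theorem equiv_euler {V : Opens X} (h : V ≤ U) (i : ℤ) (a : M.sec V i) :
    e.equiv V h i (e.euler g V i a) =
      localModel.euler (smoothRestrict g V) i (e.equiv V h i a) := by
  rw [euler, dif_pos h]
  exact LinearEquiv.apply_symm_apply _ _

theorem equiv_ofBase {V : Opens X} (h : V ≤ U) :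
    e.equiv V h 0 (e.ofBase g V) = localModel.ofBase d V (smoothRestrict g V) := by
  rw [ofBase, dif_pos h]
  exact LinearEquiv.apply_symm_apply _ _

theorem euler_eq_zero {V : Opens X} (hg : ∀ x ∈ V, g x = 0) (i : ℤ) : e.euler g V i = 0 := by
  by_cases h : V ≤ U
  · have h0 : smoothRestrict g V = 0 := by
      ext x
      exact hg x x.2
    ext a
    refine (e.equiv V h i).injective ?_
    rw [equiv_euler, h0, localModel.euler_zero, LinearMap.zero_apply, map_zero]
  · rw [euler, dif_neg h]

theorem euler_mul {V : Opens X} (hV : V ≤ U) {i j k : ℤ} (h : i + j = k) (a : M.sec V i)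
    (b : M.sec V j) : e.euler g V k (M.mul V h a b) =
      M.mul V h (e.euler g V i a) b + M.mul V h a (e.euler g V j b) := by
  refine (e.equiv V hV k).injective ?_
  rw [equiv_euler, e.map_mul, map_add, e.map_mul, e.map_mul, equiv_euler, equiv_euler,
    localModel.euler_mul]

theorem res_euler {V V' : Opens X} (hV : V ≤ U) (h : V' ≤ V) (i : ℤ) (a : M.sec V i) :
    e.euler g V' i (M.res h i a) = M.res h i (e.euler g V i a) := by
  refine (e.equiv V' (h.trans hV) i).injective ?_
  rw [equiv_euler, e.map_res V' V (h.trans hV) hV, e.map_res V' V (h.trans hV) hV, equiv_euler,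
    localModel.res_euler]
  rfl

theorem euler_sub_mem_nhd {V : Opens X} (hV : V ≤ U) {i : ℤ} {q : ℕ} {a : M.sec V i}
    (ha : a ∈ M.nhd q V i) :
    e.euler g V i a - (q : ℝ) • M.mul V (zero_add i) (e.ofBase g V) a ∈ M.nhd (q + 1) V i := by
  rw [← e.mem_nhd_iff V hV, map_sub, map_smul, e.map_mul, equiv_euler, equiv_ofBase]
  exact localModel.euler_sub_mem_nhd _ ((e.mem_nhd_iff V hV q i a).2 ha)

/-- Modulo `F^1`, the section which corresponds to a function of the base does not depend on the
chart. -/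
theorem equiv_ofBase_sub_mem_nhd {U' : Opens X} {d' : ℤ → ℕ} (hd' : d' 0 = 0)
    (e' : IsoOn U' M (localModel n X d')) {V : Opens X} (hV : V ≤ U) (hV' : V ≤ U') :
    e'.equiv V hV' 0 (e.ofBase g V) - localModel.ofBase d' V (smoothRestrict g V) ∈
      (localModel n X d').nhd 1 V 0 := by
  have h := body_equiv_ofBase ((e.mono hV).symm.trans (e'.mono hV')) le_rfl (smoothRestrict g V)
  have h1 : ((e.mono hV).symm.trans (e'.mono hV')).equiv V le_rfl 0
      (localModel.ofBase d V (smoothRestrict g V)) = e'.equiv V hV' 0 (e.ofBase g V) := by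
    rw [ofBase, dif_pos hV]
    rfl
  rw [h1] at h
  have := localModel.sub_ofBase_body_mem_nhd hd' (e'.equiv V hV' 0 (e.ofBase g V))
  rwa [h] at this

end GradedPresheaf.IsoOn

theorem IsGradedManifold.nonempty_eulerField [IsManifold (𝓡 n) ∞ X] [T2Space X]
    [SecondCountableTopology X] (hM : IsGradedManifold n M) : Nonempty M.EulerField := by
  choose U hxU d hd e using hM.locally_model
  replace e : ∀ x, IsoOn (U x) M (localModel n X (d x)) := fun x => (e x).some
  have : LocallyCompactSpace X := ChartedSpace.locallyCompactSpace (EuclideanSpace ℝ (Fin n)) X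
  obtain ⟨f, hf⟩ := SmoothPartitionOfUnity.exists_isSubordinate (𝓡 n) (s := (Set.univ : Set X))
    isClosed_univ (fun x => (U x : Set X)) (fun x => (U x).isOpen)
    (fun x _ => Set.mem_iUnion.2 ⟨x, hxU x⟩)
  -- The chart Euler fields are glued on the open sets on which only finitely many functions of the
  -- partition of unity do not vanish, and on which the corresponding charts are defined.
  let G : Opens X → Finset X → Prop := fun V s =>
    (∀ k ∈ s, V ≤ U k) ∧ ∀ k ∉ s, ∀ x ∈ V, f k x = 0
  let S : Opens X → Prop := fun V => (∃ j, V ≤ U j) ∧ ∃ s, G V s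
  let D : ∀ (V : Opens X) (i : ℤ), M.sec V i →ₗ[ℝ] M.sec V i := fun V i =>
    ∑ᶠ k, (e k).euler (f k) V i
  have hD : ∀ {V : Opens X} {s : Finset X}, G V s → ∀ (i : ℤ) (a : M.sec V i),
      D V i a = ∑ k ∈ s, (e k).euler (f k) V i a := by
    intro V s hs i a
    have : D V i = ∑ k ∈ s, (e k).euler (f k) V i := by
      refine finsum_eq_sum_of_support_subset _ fun k hk => ?_
      by_contra hks
      exact hk ((e k).euler_eq_zero (f k) (hs.2 k hks) i)
    rw [this, LinearMap.sum_apply]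
  have hanti : ∀ {V V' : Opens X} {s : Finset X}, V' ≤ V → G V s → G V' s :=
    fun h hs => ⟨fun k hk => h.trans (hs.1 k hk), fun k hk x hx => hs.2 k hk x (h hx)⟩
  refine hM.isSheaf.nonempty_eulerField S ?_ ?_ D ?_ ?_ ?_
  · intro W x hx
    have h1 : ∀ᶠ y in nhds x, ∀ k ∈ f.fintsupport x, y ∈ U k :=
      (Filter.eventually_all_finset _).2 fun k hk => (U k).isOpen.mem_nhds
        (hf k ((f.mem_fintsupport_iff x k).1 hk))
    have h2 : ∀ᶠ y in nhds x, y ∈ W ∧ y ∈ U x :=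
      Filter.Eventually.and (W.isOpen.mem_nhds hx) ((U x).isOpen.mem_nhds (hxU x))
    obtain ⟨V, hV, hVo, hxV⟩ :=
      mem_nhds_iff.1 ((h1.and h2).and (f.eventually_finsupport_subset x))
    refine ⟨⟨V, hVo⟩, fun y hy => (hV hy).1.2.1, hxV, ⟨x, fun y hy => (hV hy).1.2.2⟩,
      f.fintsupport x, fun k hk y hy => (hV hy).1.1 k hk, fun k hk y hy => ?_⟩
    by_contra h0
    exact hk ((hV hy).2 ((f.mem_finsupport y).2 h0))
  · rintro V V' h ⟨⟨j, hj⟩, s, hs⟩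
    exact ⟨⟨j, h.trans hj⟩, s, hanti h hs⟩
  · rintro V ⟨-, s, hs⟩ i j k h a b
    rw [hD hs, hD hs, hD hs, map_sum, map_sum, LinearMap.sum_apply, ← Finset.sum_add_distrib]
    exact Finset.sum_congr rfl fun l hl => (e l).euler_mul (f l) (hs.1 l hl) h a b
  · rintro V V' h ⟨-, s, hs⟩ i a
    rw [hD hs, hD (hanti h hs), map_sum]
    exact Finset.sum_congr rfl fun l hl => (e l).res_euler (f l) (hs.1 l hl) h i a
  · rintro V ⟨⟨j, hj⟩, s, hs⟩ i q a ha
    have hsum : ∑ k ∈ s, smoothRestrict (f k) V = 1 := by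
      ext x
      have h1 : f.finsupport (x : X) ⊆ s := fun k hk => by
        by_contra hks
        exact (f.mem_finsupport (x : X)).1 hk (hs.2 k hks x x.2)
      rw [← ContMDiffMap.coeFnRingHom_apply, map_sum, Finset.sum_apply]
      exact f.sum_finsupport' x.1 (Set.mem_univ _) h1
    have h1 : ∑ k ∈ s, (e k).ofBase (f k) V - M.one V ∈ M.nhd 1 V 0 := by
      rw [← (e j).mem_nhd_iff V hj, map_sub, map_sum, (e j).map_one, ← localModel.ofBase_one,
        ← hsum, map_sum, ← Finset.sum_sub_distrib]
      exact Submodule.sum_mem _ fun k hk =>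
        (e k).equiv_ofBase_sub_mem_nhd (f k) (hd j) (e j) (hs.1 k hk) hj
    have h2 : M.mul V (zero_add i) (∑ k ∈ s, (e k).ofBase (f k) V - M.one V) a ∈
        M.nhd (q + 1) V i := by
      rw [← hM.canFil_eq_nhd] at h1 ha ⊢
      exact M.mul_mem_canFil (Nat.add_comm 1 q) _ h1 ha
    have h3 := Submodule.sum_mem _ fun k hk =>
      (e k).euler_sub_mem_nhd (f k) (hs.1 k hk) ha
    have h4 := add_mem h3 (Submodule.smul_mem _ (q : ℝ) h2)
    rw [map_sub, LinearMap.sub_apply, M.one_mul, map_sum, LinearMap.sum_apply, smul_sub,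
      Finset.smul_sum, Finset.sum_sub_distrib, sub_add_sub_cancel] at h4
    rwa [hD hs]

end EulerField

end

theorem mainTheorem2 (n : ℕ) (X : Type u) [TopologicalSpace X]
    [ChartedSpace (EuclideanSpace ℝ (Fin n)) X] [IsManifold (𝓡 n) ∞ X]
    [T2Space X] [SecondCountableTopology X]
    (M : GradedPresheaf.{u, v} X) (hM : IsGradedManifold n M) :
    IsGradedManifold n M.bar ∧ Nonempty (GradedPresheaf.Iso M M.bar) := by
  obtain ⟨E⟩ := hM.nonempty_eulerField
  let e := (E.barIso hM.isComplete hM.canFil_eq_nhd).symm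
  exact ⟨hM.of_iso e, ⟨e⟩⟩
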